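/- **Setting.** For $v\in\mathbb C^k$ let $\|v\|_2$ be the Euclidean norm. Let $\{\mathcal I_b\}_{b=1}^B$ be a partition of a finite index set $I$. For $x\in\mathbb C^I$ let $x[b]$ be the subvector with indices in $\mathcal I_b$; $x$ is *group $S$-sparse* if at most $S$ of the $x[b]$ are nonzero, and $\|x\|_{2|\mathcal P}=\sum_b\|x[b]\|_2$. A matrix $\Phi$ has the *group restricted isometry property* (G-RIP) of order $S$ if for some $\delta\in(0,1)$ one has $(1-\delta)\|x\|_2^2\le\|\Phi x\|_2^2\le(1+\delta)\|x\|_2^2$ for all group $S$-sparse $x$; the smallest $\delta\ge 0$ for which this holds is its constant $\delta_{S|\mathcal P}$ (G-RIC). *System.* Let $N_T,N_R$ be the numbers of transmit and receive antennas, $\Theta=\{(r,s):1\le r\le N_R,\,1\le s\le N_T\}$, and let $K,L,Q\ge1$, $D\mid K$, $J\mid L$, $J$ even, $\Delta K=K/D$, $\Delta L=L/J$. The channel is $$H_{l,k}=\sum_{m=0}^{K-1}\sum_{i=-L/2}^{L/2-1}F_{m,i}\,e^{-2\pi \mathrm j(km/K-li/L)}\in\mathbb C^{N_R\times N_T},\qquad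 0\le l<L,\ 0\le k<K,$$ where $F_{m,i}\in\mathbb C^{N_R\times N_T}$ vanishes for $(m,i)\notin\{0,\dots,D-1\}\times\{-J/2,\dots,J/2-1\}$. Let $\{u_{m,i}\}$, indexed by these $JD$ pairs $(m,i)$, be an orthonormal basis of the functions on $\{0,\dots,J-1\}\times\{0,\dots,D-1\}$, and define $G_{m,i}\in\mathbb C^{N_R\times N_T}$ by $H_{\lambda\Delta L,\kappa\Delta K}=\sum_{m,i}G_{m,i}\,u_{m,i}[\lambda,\kappa]$. Write $G^{(\theta)}_{m,i}$ and $H^{(\theta)}_{l,k}$ for the entries with index $\theta=(r,s)$, and $G^{(\theta)}=(G^{(\theta)}_{m,i})_{(m,i)}$. Let $p^{(1)},\dots,p^{(N_T)}\in\mathbb C^{N_T}$ be linearly independent pilot vectors and $P=(p^{(1)}\cdots p^{(N_T)})$. Let $\mathcal P^{(1)},\dots,\mathcal P^{(N_T)}$ be pairwise disjoint sets of $Q$ pilot positions $\mu^{(s)}_q=(\lambda^{(s)}_q\Delta L,\kappa^{(s)}_q\Delta K)$, $1\le q\le Q$, in the subsampled grid. The received vectors are $y_{l,k}=H_{l,k}a_{l,k}+z_{l,k}$,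 where the transmitted vectors satisfy $a_\mu=p^{(s)}$ for all $\mu\in\mathcal P^{(s)}$. For $\theta=(r,s)$ put $y^{(\theta)}=([y_{\mu^{(s)}_q}]_r)_{q}$ and $z^{(\theta)}=([z_{\mu^{(s)}_q}]_r)_{q}$. Let $\Phi^{(s)}\in\mathbb C^{Q\times JD}$ have entries $\sqrt{JD/Q}\;u_{m,i}[\lambda^{(s)}_q,\kappa^{(s)}_q]$. *Estimator.* Fix a partition $\mathcal P=\{\mathcal I_b\}_{b=1}^B$ of the set of the $JD$ index pairs $(m,i)$. Let $y$ be the stack of the $y^{(\theta)}$, $\theta\in\Theta$; let $\Phi$ be the block-diagonal matrix whose block for $\theta=(r,s)$ is $\Phi^{(s)}$; and let $\tilde{\mathcal P}=\{\mathcal I_b\times\Theta\}_{b=1}^B$ be the stacked partition. Obtain $\hat x=(\hat x^{(\theta)})_\theta$ from $(y,\Phi,\tilde{\mathcal P})$ by one of the following methods (this is *MGCS mode*). * *G-BPDN* (given $\epsilon>0$): $\hat x$ minimizes $\|x'\|_{2|\tilde{\mathcal P}}$ subject to $\|\Phi x'-y\|_2\le\epsilon$. * *G-CoSaMP* with $n$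 iterations (given $S\ge 1$): start with $\hat x_0=0$. In each iteration, let $\Omega$ be the set of groups on which a best group $2S$-sparse approximation (in $\|\cdot\|_2$) of $\Phi^H(y-\Phi\hat x_{j-1})$ is nonzero; let $T$ be the union of $\Omega$ with the set of groups on which $\hat x_{j-1}$ is nonzero; let $b$ minimize $\|y-\Phi b\|_2$ among vectors vanishing outside the groups in $T$; let $\hat x_j$ be a best group $S$-sparse approximation of $b$ in $\|\cdot\|_2$. Ties are broken arbitrarily, and $\hat x=\hat x_n$. Then put $\hat{\tilde G}^{(\theta)}_{m,i}=\sqrt{JD/Q}\;\hat x^{(\theta)}_{m,i}$; let the $r$th row of $\hat G_{m,i}$ be the transpose of $P^{-T}\big(\hat{\tilde G}^{(r,1)}_{m,i},\dots,\hat{\tilde G}^{(r,N_T)}_{m,i}\big)^T$; put $\hat H_{\lambda\Delta L,\kappa\Delta K}=\sum_{m,i}\hat G_{m,i}u_{m,i}[\lambda,\kappa]$; let $\hat F_{m,i}=\frac1{JD}\sum_{\lambda=0}^{J-1}\sum_{\kappa=0}^{D-1}\hat H_{\lambda\Delta L,\kappa\Delta K}\,e^{-2\pi \mathrm j(i\lambda/J-m\kappa/D)}$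 for $0\le m<D$, $-J/2\le i<J/2$, and $\hat F_{m,i}=0$ otherwise; and obtain the channel estimate $\hat H_{l,k}$ from $\hat F_{m,i}$ in the same way as $H_{l,k}$ from $F_{m,i}$. The estimation error is $$E=\sqrt{\sum_{\theta\in\Theta}\sum_{l=0}^{L-1}\sum_{k=0}^{K-1}\big|\hat H^{(\theta)}_{l,k}-H^{(\theta)}_{l,k}\big|^2}.$$ For $\mathcal S\subseteq\{1,\dots,B\}$ with $|\mathcal S|=S\ge1$ let $C_{G,\mathcal S,\mathcal P}=\sum_{b\notin\mathcal S}\sqrt{\sum_{\theta\in\Theta}\|G^{(\theta)}[b]\|_2^2}$, and let $C_P=\|P\|\,\|P^{-1}\|$ with the spectral norm $\|\cdot\|$. **Theorem.** Let $\epsilon>0$ and assume $\sqrt{\sum_{\theta\in\Theta}\|z^{(\theta)}\|_2^2}\le\epsilon$. 1. Suppose $\hat x$ is a solution of G-BPDN in MGCS mode. If every $\Phi^{(s)}$ has the G-RIP of order $2S$ with respect to $\mathcal P$ with G-RIC $\delta^{(s)}_{2S|\mathcal P}<\sqrt2-1$, then $$E\le C_0'\,\frac{C_{G,\mathcal S,\mathcal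 P}}{\sqrt S}+C_1'\,\epsilon,\qquad C_0'=c_0\sqrt{\tfrac{KL}{JD}}\,C_P,\quad C_1'=c_1\sqrt{\tfrac{KL}{Q}}\,\|P^{-1}\|,$$ where $c_0=\frac{2(1-\delta)}{1-(1+\sqrt2)\delta}$, $c_1=\frac{4\sqrt{1+\delta}}{1-(1+\sqrt2)\delta}$, and $\delta$ is the G-RIC of order $2S$ of $\Phi$ with respect to $\tilde{\mathcal P}$. 2. Suppose $\hat x$ is the result of $n\ge0$ iterations of G-CoSaMP in MGCS mode. If every $\Phi^{(s)}$ has the G-RIP of order $4S$ with respect to $\mathcal P$ with G-RIC $\delta^{(s)}_{4S|\mathcal P}\le0.1$, then $$E\le C_0''\Big(1+\frac1{\sqrt S}\Big)C_{G,\mathcal S,\mathcal P}+C_1''\,\epsilon+C_2''(n),$$ where $C_0''=20\sqrt{\tfrac{KL}{JD}}\,C_P$, $C_1''=20\sqrt{\tfrac{KL}{Q}}\,\|P^{-1}\|$ and $C_2''(n)=\frac1{2^n}\,C_P\sqrt{\frac{KL}{JD}\sum_{\theta\in\Theta}\sum_{m=0}^{D-1}\sum_{i=-J/2}^{J/2-1}\big|G^{(\theta)}_{m,i}\big|^2}$.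 -/

import Mathlib

open scoped Matrix

noncomputable section

namespace MGCS

/-! ## Group-sparse compressed sensing over `ℂ` -/

/-- The Euclidean norm of a finitely indexed complex vector. -/
def l2norm {ι : Type*} [Fintype ι] (v : ι → ℂ) : ℝ :=
  ‖(WithLp.toLp 2 v : EuclideanSpace ℂ ι)‖

section Groups

variable {ι ρ β : Type*} [Fintype ι] [Fintype ρ] [Fintype β] [DecidableEq β]

/-- A partition `{I_b}` of the index set `ι` is encoded by the map `g` that sends an index `j` to
the label `b` of the group that contains it, so `I_b = {j | g j = b}`. This is the subvector
`x[b]` of `x` made of the entries with index in `I_b`. -/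
def subvec (g : ι → β) (x : ι → ℂ) (b : β) : {j // g j = b} → ℂ := fun j => x j

/-- The set of groups on which `x` is not identically zero. -/
def groupSupp (g : ι → β) (x : ι → ℂ) : Set β := {b | subvec g x b ≠ 0}

/-- `x` is group `S`-sparse: at most `S` of its subvectors are not identically zero. -/
def GroupSparse (g : ι → β) (S : ℕ) (x : ι → ℂ) : Prop := (groupSupp g x).ncard ≤ S

/-- The mixed norm: the sum over the groups of the Euclidean norms of the subvectors. -/
def mixedNorm (g : ι → β) (x : ι → ℂ) : ℝ := ∑ b, l2norm (subvec g x b)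

/-- The double inequality of the group restricted isometry property of order `S`. -/
def GRIPWith (g : ι → β) (S : ℕ) (Φ : Matrix ρ ι ℂ) (δ : ℝ) : Prop :=
  ∀ x : ι → ℂ, GroupSparse g S x →
    (1 - δ) * l2norm x ^ 2 ≤ l2norm (Φ *ᵥ x) ^ 2 ∧
      l2norm (Φ *ᵥ x) ^ 2 ≤ (1 + δ) * l2norm x ^ 2

/-- The group restricted isometry property of order `S`. -/
def HasGRIP (g : ι → β) (S : ℕ) (Φ : Matrix ρ ι ℂ) : Prop :=
  ∃ δ : ℝ, 0 < δ ∧ δ < 1 ∧ GRIPWith g S Φ δ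

/-- The group restricted isometry constant of order `S`: the smallest `δ ≥ 0` for which the double
inequality holds. -/
def gRIC (g : ι → β) (S : ℕ) (Φ : Matrix ρ ι ℂ) : ℝ :=
  sInf {δ : ℝ | 0 ≤ δ ∧ GRIPWith g S Φ δ}

/-- `xh` solves the group basis pursuit denoising program: minimize the mixed norm of `x'` subject
to `‖Φ x' - y‖ ≤ ε`. -/
def IsGBPDNSolution (g : ι → β) (Φ : Matrix ρ ι ℂ) (y : ρ → ℂ) (ε : ℝ) (xh : ι → ℂ) : Prop :=
  l2norm (Φ *ᵥ xh - y) ≤ ε ∧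
    ∀ x' : ι → ℂ, l2norm (Φ *ᵥ x' - y) ≤ ε → mixedNorm g xh ≤ mixedNorm g x'

/-- `w` is a best group `S`-sparse approximation of `v` in the Euclidean norm; equivalently, it
keeps `S` groups of `v` with largest Euclidean norm (ties broken arbitrarily) and sets the other
groups to zero. -/
def IsBestGroupApprox (g : ι → β) (S : ℕ) (v w : ι → ℂ) : Prop :=
  GroupSparse g S w ∧ ∀ w' : ι → ℂ, GroupSparse g S w' → l2norm (v - w) ≤ l2norm (v - w')

/-- `b` is a least-squares solution of `Φ b = y` among the vectors vanishing outside the groups in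
`T`. It is unique, equal to the pseudoinverse solution, as soon as the corresponding columns
of `Φ` are linearly independent. -/
def IsGroupLeastSquares (g : ι → β) (Φ : Matrix ρ ι ℂ) (y : ρ → ℂ) (T : Set β)
    (b : ι → ℂ) : Prop :=
  groupSupp g b ⊆ T ∧
    ∀ b' : ι → ℂ, groupSupp g b' ⊆ T → l2norm (y - Φ *ᵥ b) ≤ l2norm (y - Φ *ᵥ b')

/-- One iteration of group CoSaMP (model-based CoSaMP for the group sparsity model), from the
estimate `x` to the estimate `x'`: form the proxy `Φᴴ (y - Φ x)`, find the groups `Ω` supporting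
its best group `2S`-sparse approximation, merge `Ω` with the group support of `x`, solve the
least-squares problem on the merged groups, and prune the result to `S` groups. -/
def IsGCoSaMPStep (g : ι → β) (S : ℕ) (Φ : Matrix ρ ι ℂ) (y : ρ → ℂ) (x x' : ι → ℂ) : Prop :=
  ∃ w b : ι → ℂ,
    IsBestGroupApprox g (2 * S) (Φᴴ *ᵥ (y - Φ *ᵥ x)) w ∧
    IsGroupLeastSquares g Φ y (groupSupp g w ∪ groupSupp g x) b ∧
    IsBestGroupApprox g S b x'

/-- `IsGCoSaMPIterate g S Φ y n x`: group CoSaMP, started at zero, can have the estimate `x` after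
`n` iterations (the only freedom is in the breaking of ties). -/
inductive IsGCoSaMPIterate (g : ι → β) (S : ℕ) (Φ : Matrix ρ ι ℂ) (y : ρ → ℂ) :
    ℕ → (ι → ℂ) → Prop
  | zero : IsGCoSaMPIterate g S Φ y 0 0
  | succ {n : ℕ} {x x' : ι → ℂ} : IsGCoSaMPIterate g S Φ y n x → IsGCoSaMPStep g S Φ y x x' →
      IsGCoSaMPIterate g S Φ y (n + 1) x'

end Groups

/-- The spectral norm of a square matrix. -/
def specNorm {n : ℕ} (A : Matrix (Fin n) (Fin n) ℂ) : ℝ :=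
  ‖Matrix.toEuclideanCLM (𝕜 := ℂ) A‖

/-- First error constant of group basis pursuit denoising, for the isometry constant `δ`. -/
def c0 (δ : ℝ) : ℝ := 2 * (1 - δ) / (1 - (1 + √2) * δ)

/-- Second error constant of group basis pursuit denoising, for the isometry constant `δ`. -/
def c1 (δ : ℝ) : ℝ := 4 * √(1 + δ) / (1 - (1 + √2) * δ)

/-! ## The multicarrier MIMO system and the channel estimator -/

/-- The fixed design parameters: `NT` transmit and `NR` receive antennas, `K` subcarriers,
`L` symbols, a `D × J` delay-Doppler support region, `Q` pilot positions per transmit antenna;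
an orthonormal basis `u_{m,i}[lam, kap]` of functions on the subsampled time-frequency grid;
linearly independent pilot vectors `p^(s)`; and pairwise disjoint pilot position sets.

A pair `(m, i)` in `Fin D × Fin J` stands for the delay `m` and the Doppler shift `i - J/2`; a pair
`(lam, kap)` in `Fin J × Fin D` stands for the grid point `(lam * (L/J), kap * (K/D))`. -/
structure MIMOSystem where
  NT : ℕ
  NR : ℕ
  K : ℕ
  L : ℕ
  D : ℕ
  J : ℕ
  Q : ℕ
  K_pos : 0 < K
  L_pos : 0 < L
  Q_pos : 0 < Q
  D_dvd_K : D ∣ K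
  J_dvd_L : J ∣ L
  J_even : Even J
  /-- the orthonormal basis `u` -/
  u : OrthonormalBasis (Fin D × Fin J) ℂ (EuclideanSpace ℂ (Fin J × Fin D))
  /-- the pilot vectors: `p s t` is the `t`-th entry of `p^(s)` -/
  p : Fin NT → Fin NT → ℂ
  p_indep : LinearIndependent ℂ p
  /-- `pos s q` is the `q`-th pilot position `(lam, kap)` of the `s`-th pilot set -/
  pos : Fin NT → Fin Q → Fin J × Fin D
  /-- the positions within a set are distinct, and the sets are pairwise disjoint -/
  pos_injective : Function.Injective fun sq : Fin NT × Fin Q => pos sq.1 sq.2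

namespace MIMOSystem

variable (sys : MIMOSystem)

/-- `NR × NT` complex matrices. -/
abbrev Mat : Type := Matrix (Fin sys.NR) (Fin sys.NT) ℂ

/-- The set of channel indices `θ = (r, s)`. -/
abbrev Chan : Type := Fin sys.NR × Fin sys.NT

/-- The index set of the delay-Doppler coefficients. -/
abbrev DD : Type := Fin sys.D × Fin sys.J

/-- The integers `-n/2, …, n/2 - 1` (for even `n`). -/
def dopplerRange (n : ℕ) : Finset ℤ := Finset.Ico (-((n / 2 : ℕ) : ℤ)) ((n / 2 : ℕ) : ℤ)

/-- The two-dimensional DFT expansion giving the channel coefficient matrix at the time-frequency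
position `(l, k)` from delay-Doppler coefficients `F m i`. -/
def channel (F : ℕ → ℤ → sys.Mat) (l k : ℕ) : sys.Mat :=
  ∑ m ∈ Finset.range sys.K, ∑ i ∈ dopplerRange sys.L,
    Complex.exp (-2 * Real.pi * Complex.I *
      ((k : ℂ) * (m : ℂ) / (sys.K : ℂ) - (l : ℂ) * (i : ℂ) / (sys.L : ℂ))) • F m i

/-- Within the fundamental region, `F` vanishes outside
`{0, …, D - 1} × {-J/2, …, J/2 - 1}`. -/
def SupportedInRegion (F : ℕ → ℤ → sys.Mat) : Prop :=
  ∀ m < sys.K, ∀ i ∈ dopplerRange sys.L, F m i ≠ 0 → m < sys.D ∧ i ∈ dopplerRange sys.J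

/-- The symbol time of a subsampled grid point. -/
def gridTime (μ : Fin sys.J × Fin sys.D) : ℕ := μ.1 * (sys.L / sys.J)

/-- The subcarrier of a subsampled grid point. -/
def gridFreq (μ : Fin sys.J × Fin sys.D) : ℕ := μ.2 * (sys.K / sys.D)

/-- The coefficient matrices `G_{m,i}` of the subsampled channel in the orthonormal basis `u`. -/
def coeff (F : ℕ → ℤ → sys.Mat) (c : sys.DD) : sys.Mat :=
  Matrix.of fun r s =>
    sys.u.repr (WithLp.toLp 2 fun μ => sys.channel F (sys.gridTime μ) (sys.gridFreq μ) r s) c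

/-- The pilot matrix `P`, whose columns are the pilot vectors. -/
def pilotMatrix : Matrix (Fin sys.NT) (Fin sys.NT) ℂ := Matrix.of fun t s => sys.p s t

/-- The measurement matrix `Φ^(s)`: the rows of the unitary matrix with columns `u_{m,i}` that
belong to the `s`-th pilot set, scaled by `√(JD/Q)`. -/
def Phi (s : Fin sys.NT) : Matrix (Fin sys.Q) sys.DD ℂ :=
  Matrix.of fun q c => (√((sys.J * sys.D : ℝ) / sys.Q) : ℂ) * sys.u c (sys.pos s q)

/-- The stacked block-diagonal measurement matrix with blocks `Φ^(s)`, `θ = (r, s)`. -/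
def PhiStack : Matrix (Fin sys.Q × sys.Chan) (sys.DD × sys.Chan) ℂ :=
  Matrix.blockDiagonal fun θ : sys.Chan => sys.Phi θ.2

/-- The stacked partition: the `b`-th group collects the indices of the `b`-th group of `g` for
all channels. -/
def stackPartition {β : Type*} (g : sys.DD → β) : sys.DD × sys.Chan → β := fun jθ => g jθ.1

/-- The demodulated symbols `y_{l,k} = H_{l,k} a_{l,k} + z_{l,k}`. -/
def received (F : ℕ → ℤ → sys.Mat) (a : ℕ → ℕ → Fin sys.NT → ℂ) (z : ℕ → ℕ → Fin sys.NR → ℂ)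
    (l k : ℕ) : Fin sys.NR → ℂ :=
  sys.channel F l k *ᵥ a l k + z l k

/-- The vector of the values at receive antenna `r` and at the pilot positions of the `s`-th pilot
set, for `θ = (r, s)`. -/
def atPilots (v : ℕ → ℕ → Fin sys.NR → ℂ) (θ : sys.Chan) : Fin sys.Q → ℂ :=
  fun q => v (sys.gridTime (sys.pos θ.2 q)) (sys.gridFreq (sys.pos θ.2 q)) θ.1

/-- The stack over all channels of the vectors `atPilots v θ`. -/
def stackPilots (v : ℕ → ℕ → Fin sys.NR → ℂ) : Fin sys.Q × sys.Chan → ℂ :=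
  fun qθ => sys.atPilots v qθ.2 qθ.1

/-- The pilot vector `p^(s)` is transmitted at all positions of the `s`-th pilot set. -/
def TransmitsPilots (a : ℕ → ℕ → Fin sys.NT → ℂ) : Prop :=
  ∀ s q, a (sys.gridTime (sys.pos s q)) (sys.gridFreq (sys.pos s q)) = sys.p s

/-- Rescaling of the stacked compressed sensing estimate `xh`. -/
def GtildeHat (xh : sys.DD × sys.Chan → ℂ) (c : sys.DD) : sys.Mat :=
  Matrix.of fun r s => (√((sys.J * sys.D : ℝ) / sys.Q) : ℂ) * xh (c, (r, s))

/-- Estimates of the coefficient matrices: the `r`-th row is `P^{-T}` applied to the `r`-th row of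
`GtildeHat`. -/
def GHat (xh : sys.DD × sys.Chan → ℂ) (c : sys.DD) : sys.Mat :=
  Matrix.of fun r => (sys.pilotMatrixᵀ)⁻¹ *ᵥ sys.GtildeHat xh c r

/-- Estimates of the subsampled channel coefficient matrices. -/
def HSubHat (xh : sys.DD × sys.Chan → ℂ) (μ : Fin sys.J × Fin sys.D) : sys.Mat :=
  ∑ c : sys.DD, sys.u c μ • sys.GHat xh c

/-- Estimates of the delay-Doppler coefficients, by the inverse two-dimensional DFT. -/
def FHat (xh : sys.DD × sys.Chan → ℂ) (m : ℕ) (i : ℤ) : sys.Mat :=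
  if m < sys.D ∧ i ∈ dopplerRange sys.J then
    (1 / ((sys.J : ℂ) * (sys.D : ℂ))) • ∑ lam : Fin sys.J, ∑ kap : Fin sys.D,
      Complex.exp (-2 * Real.pi * Complex.I *
        ((i : ℂ) * ((lam : ℕ) : ℂ) / (sys.J : ℂ) - (m : ℂ) * ((kap : ℕ) : ℂ) / (sys.D : ℂ))) •
        sys.HSubHat xh (lam, kap)
  else 0

/-- The estimates of all channel coefficient matrices. -/
def HHat (xh : sys.DD × sys.Chan → ℂ) (l k : ℕ) : sys.Mat := sys.channel (sys.FHat xh) l k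

/-- The estimation error `E` (root of the sum of squared errors over all channels and positions)
of the estimator that obtains `xh` from compressed sensing. -/
def rmse (F : ℕ → ℤ → sys.Mat) (xh : sys.DD × sys.Chan → ℂ) : ℝ :=
  √(∑ θ : sys.Chan, ∑ l ∈ Finset.range sys.L, ∑ k ∈ Finset.range sys.K,
    ‖sys.HHat xh l k θ.1 θ.2 - sys.channel F l k θ.1 θ.2‖ ^ 2)

/-- The leakage of the coefficients `G_{m,i}` outside the groups with label in `A`. -/
def leakage {β : Type*} [Fintype β] [DecidableEq β] (g : sys.DD → β) (A : Finset β)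
    (F : ℕ → ℤ → sys.Mat) : ℝ :=
  ∑ b ∈ Aᶜ, √(∑ θ : sys.Chan, l2norm (subvec g (fun c => sys.coeff F c θ.1 θ.2) b) ^ 2)

/-- `C_P = ‖P‖ ‖P⁻¹‖`. -/
def CP : ℝ := specNorm sys.pilotMatrix * specNorm sys.pilotMatrix⁻¹

end MIMOSystem

end MGCS

end

/-! The estimator is compressed sensing placed between two nearly isometric changes of coordinates.
Let x be the stack of the vectors √(Q/JD) (Pᵀ G)^(θ), where Pᵀ acts on each row of G (`measured`).
On the s-th pilot set the channel acts on p^(s), which picks out the s-th column of the coefficients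
after Pᵀ, so y = Φx + z and the noise assumption reads ‖Φx - y‖ ≤ ε (`PhiStack_mulVec_measured`).
Each channel slice of a group n-sparse stacked vector is group n-sparse, so adding the blockwise
inequalities shows that Φ inherits the G-RIP with the largest of the block constants
(`gRIPWith_blockDiagonal`).

The recovery bounds are proved for abstract block projections in a real inner product space; complex
vectors enter through the real part of their inner product. For G-BPDN, minimality puts the error h
in a cone, and the RIP bounds h on the support and the S largest further groups. Bounding the
remaining groups by the triangle inequality would give the constant 2(1+ρ)/(1-ρ) with ρ = √2δ/(1-δ).
The required c₀ = 2/(1-ρ) is smaller; it comes from Pythagoras together with a tail estimate that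
keeps the factor ‖h_T‖ (`bpdn_scalar_bound`). For G-CoSaMP, identification, least squares and
pruning together contract the error to the sparse part of x by 1/2 (`cosamp_step_bound`); the part
of x off the chosen groups is counted as noise.

Finally, inverse and forward DFT interpolation scale the squared error by exactly KL/(JD)
(`dft_interpolation_error`), the basis u is orthonormal, and undoing Pᵀ costs ‖P⁻¹‖ (`rmse_le`).
Passing from G to x costs ‖P‖ and √(Q/JD), group by group (`leakage_measured_le`). The product of
these factors is √(KL/JD) C_P for signal terms and √(KL/Q) ‖P⁻¹‖ for noise. -/

noncomputable section

namespace MGCS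

/-! ## Orthogonal block decompositions and the restricted isometry property -/

section Block

variable {β E F : Type*} [Fintype β] [DecidableEq β]
  [NormedAddCommGroup E] [InnerProductSpace ℝ E] [NormedAddCommGroup F] [InnerProductSpace ℝ F]

/-- `p V` is the orthogonal projection onto the sum of the blocks with label in `V`, for a family
of mutually orthogonal blocks that span the space. -/
structure IsBlockProj (p : Finset β → E →ₗ[ℝ] E) : Prop where
  comp : ∀ V W x, p V (p W x) = p (V ∩ W) x
  symm : ∀ V x y, inner ℝ (p V x) y = inner ℝ x (p V y)
  union : ∀ V W x, Disjoint V W → p (V ∪ W) x = p V x + p W x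
  univ : ∀ x, p Finset.univ x = x

/-- The restricted isometry inequality of order `n` with respect to a block decomposition. -/
def BlockRIP (p : Finset β → E →ₗ[ℝ] E) (f : E →ₗ[ℝ] F) (n : ℕ) (δ : ℝ) : Prop :=
  ∀ V : Finset β, V.card ≤ n → ∀ x, p V x = x →
    (1 - δ) * ‖x‖ ^ 2 ≤ ‖f x‖ ^ 2 ∧ ‖f x‖ ^ 2 ≤ (1 + δ) * ‖x‖ ^ 2

variable {p : Finset β → E →ₗ[ℝ] E} (hp : IsBlockProj p)
include hp

namespace IsBlockProj

lemma self (V : Finset β) (x : E) : p V (p V x) = p V x := by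
  rw [hp.comp, Finset.inter_self]

lemma empty (x : E) : p ∅ x = 0 := by
  have h := hp.union ∅ ∅ x (Finset.disjoint_empty_left _)
  simpa using h

lemma of_subset {V W : Finset β} (h : V ⊆ W) {x : E} (hx : p V x = x) : p W x = x := by
  rw [← hx, hp.comp, Finset.inter_eq_right.2 h]

lemma compl (V : Finset β) (x : E) : p V x + p Vᶜ x = x := by
  rw [← hp.union _ _ _ disjoint_compl_right, Finset.union_compl, hp.univ]

lemma inner_disjoint {V W : Finset β} (h : Disjoint V W) (x y : E) :
    inner ℝ (p V x) (p W y) = 0 := by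
  rw [hp.symm, hp.comp, Finset.disjoint_iff_inter_eq_empty.1 h, hp.empty, inner_zero_right]

lemma inner_self (V : Finset β) (x : E) : inner ℝ x (p V x) = ‖p V x‖ ^ 2 := by
  rw [← hp.self, ← hp.symm, real_inner_self_eq_norm_sq, hp.self]

lemma norm_sq_union {V W : Finset β} (h : Disjoint V W) (x : E) :
    ‖p (V ∪ W) x‖ ^ 2 = ‖p V x‖ ^ 2 + ‖p W x‖ ^ 2 := by
  rw [hp.union _ _ _ h, norm_add_sq_real, hp.inner_disjoint h]; ring

lemma norm_sq_compl (V : Finset β) (x : E) : ‖x‖ ^ 2 = ‖p V x‖ ^ 2 + ‖p Vᶜ x‖ ^ 2 := by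
  rw [← hp.norm_sq_union disjoint_compl_right, Finset.union_compl, hp.univ]

lemma norm_le (V : Finset β) (x : E) : ‖p V x‖ ≤ ‖x‖ := by
  have := hp.norm_sq_compl V x
  exact abs_le_of_sq_le_sq' (by nlinarith [sq_nonneg ‖p Vᶜ x‖]) (norm_nonneg _) |>.2

lemma norm_le_of_subset {V W : Finset β} (h : V ⊆ W) (x : E) : ‖p V x‖ ≤ ‖p W x‖ := by
  have h1 := hp.norm_le V (p W x)
  rwa [hp.comp, Finset.inter_eq_left.2 h] at h1

lemma eq_sum (V : Finset β) (x : E) : p V x = ∑ b ∈ V, p {b} x := by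
  induction V using Finset.induction_on with
  | empty => simp [hp.empty]
  | insert b V hb ih =>
    rw [Finset.sum_insert hb, Finset.insert_eq,
      hp.union _ _ _ (Finset.disjoint_singleton_left.2 hb), ih]

lemma norm_sq_eq_sum (V : Finset β) (x : E) : ‖p V x‖ ^ 2 = ∑ b ∈ V, ‖p {b} x‖ ^ 2 := by
  induction V using Finset.induction_on with
  | empty => simp [hp.empty]
  | insert b V hb ih =>
    rw [Finset.sum_insert hb, Finset.insert_eq,
      hp.norm_sq_union (Finset.disjoint_singleton_left.2 hb), ih]

lemma norm_le_sum (V : Finset β) (x : E) : ‖p V x‖ ≤ ∑ b ∈ V, ‖p {b} x‖ := by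
  rw [hp.eq_sum]; exact norm_sum_le _ _

lemma sum_le_sqrt_card (V : Finset β) (x : E) :
    ∑ b ∈ V, ‖p {b} x‖ ≤ √V.card * ‖p V x‖ := by
  have h := sq_sum_le_card_mul_sum_sq (s := V) (f := fun b => ‖p {b} x‖)
  rw [← hp.norm_sq_eq_sum] at h
  refine abs_le_of_sq_le_sq' ?_ (by positivity) |>.2
  rw [mul_pow, Real.sq_sqrt (by positivity)]
  exact h

lemma norm_le_sqrt_mul {V : Finset β} {S : ℕ} (hV : V.card ≤ S) (x : E) {M : ℝ} (hM : 0 ≤ M)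
    (h : ∀ b ∈ V, ‖p {b} x‖ ≤ M) : ‖p V x‖ ≤ √S * M := by
  refine abs_le_of_sq_le_sq' ?_ (by positivity) |>.2
  rw [mul_pow, Real.sq_sqrt (by positivity), hp.norm_sq_eq_sum]
  calc ∑ b ∈ V, ‖p {b} x‖ ^ 2 ≤ ∑ b ∈ V, M ^ 2 :=
        Finset.sum_le_sum fun b hb => pow_le_pow_left₀ (norm_nonneg _) (h b hb) 2
    _ = V.card * M ^ 2 := by simp
    _ ≤ S * M ^ 2 := by gcongr

end IsBlockProj

omit hp in
/-- A quadratic polynomial `a t² - 2 b t` that is nonnegative for all `t` has `b = 0`. -/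
lemma eq_zero_of_quadratic_nonneg {a b : ℝ} (ha : 0 ≤ a)
    (h : ∀ t : ℝ, 0 ≤ a * t ^ 2 - 2 * b * t) : b = 0 := by
  -- Dividing by a + 1 instead of a avoids a case split at a = 0, and the value is still negative
  -- unless b = 0.
  have h1 := h (b / (a + 1))
  have h2 : a * (b / (a + 1)) ^ 2 - 2 * b * (b / (a + 1)) =
      - (b ^ 2 * (a + 2) / (a + 1) ^ 2) := by
    field_simp; ring
  rw [h2] at h1
  by_contra hb
  have : 0 < b ^ 2 * (a + 2) / (a + 1) ^ 2 := by positivity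
  linarith

omit hp [Fintype β] [DecidableEq β] in
lemma norm_le_of_blockRIP {f : E →ₗ[ℝ] F} {n : ℕ} {δ c : ℝ} (hf : BlockRIP p f n δ)
    (hc : 0 ≤ c) (hδc : 1 + δ ≤ c ^ 2) {V : Finset β} (hV : V.card ≤ n) {x : E} (hx : p V x = x) :
    ‖f x‖ ≤ c * ‖x‖ := by
  refine abs_le_of_sq_le_sq' ?_ (by positivity) |>.2
  rw [mul_pow]
  exact (hf V hV x hx).2.trans (by gcongr)

/-- A restricted isometry nearly preserves the orthogonality of vectors with disjoint supports. -/
lemma abs_inner_le_of_blockRIP {f : E →ₗ[ℝ] F} {n : ℕ} {δ : ℝ} (hf : BlockRIP p f n δ)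
    {V W : Finset β} (hd : Disjoint V W) (hn : V.card + W.card ≤ n)
    {u v : E} (hu : p V u = u) (hv : p W v = v) :
    |inner ℝ (f u) (f v)| ≤ δ * ‖u‖ * ‖v‖ := by
  have huv : inner ℝ u v = 0 := by rw [← hu, ← hv]; exact hp.inner_disjoint hd u v
  -- Polarization: the upper bound at u + tv minus the lower bound at u - tv, where the two
  -- arguments have equal norm by orthogonality.
  have key : ∀ t : ℝ, 2 * t * inner ℝ (f u) (f v) ≤ δ * (‖u‖ ^ 2 + t ^ 2 * ‖v‖ ^ 2) := by
    intro t
    have hs : ∀ r : ℝ, p (V ∪ W) (u + r • v) = u + r • v := fun r => by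
      rw [map_add, map_smul, hp.of_subset Finset.subset_union_left hu,
        hp.of_subset Finset.subset_union_right hv]
    have hc : (V ∪ W).card ≤ n := (Finset.card_union_le _ _).trans hn
    have h1 := (hf _ hc _ (hs t)).2
    have h2 := (hf _ hc _ (hs (-t))).1
    simp only [map_add, map_smul, norm_add_sq_real, inner_smul_right, huv, norm_smul,
      mul_pow, Real.norm_eq_abs, sq_abs, neg_sq] at h1 h2
    linarith
  rcases eq_or_ne v 0 with rfl | hv0
  · simp
  have hvp : 0 < ‖v‖ := norm_pos_iff.2 hv0
  have e : (‖u‖ / ‖v‖) ^ 2 * ‖v‖ ^ 2 = ‖u‖ ^ 2 := by field_simp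
  rcases eq_or_ne u 0 with rfl | hu0
  · simp
  have hup : 0 < ‖u‖ := norm_pos_iff.2 hu0
  -- The choice t = ±‖u‖/‖v‖ makes u and tv equally long, which optimizes the bound.
  have h1 := key (‖u‖ / ‖v‖)
  have h2 := key (-(‖u‖ / ‖v‖))
  rw [neg_sq, e] at h2
  rw [e] at h1
  have e2 : δ * (‖u‖ ^ 2 + ‖u‖ ^ 2) = 2 * (‖u‖ / ‖v‖) * (δ * ‖u‖ * ‖v‖) := by field_simp; ring
  have hr : 0 < 2 * (‖u‖ / ‖v‖) := by positivity
  rw [e2] at h1 h2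
  rw [abs_le]
  constructor
  · refine le_of_mul_le_mul_left ?_ hr; linarith
  · exact le_of_mul_le_mul_left h1 hr

/-! ## Selection of the largest blocks -/

omit hp [Fintype β] in
lemma exists_largest_subset (a : β → ℝ) (U : Finset β) (n : ℕ) (hn : n ≤ U.card) :
    ∃ T ⊆ U, T.card = n ∧ ∀ c ∈ T, ∀ b ∈ U \ T, a b ≤ a c := by
  induction n with
  | zero => exact ⟨∅, by simp⟩
  | succ n ih =>
    obtain ⟨T, hTU, hT, hmax⟩ := ih (by omega)
    have hne : (U \ T).Nonempty := by
      rw [← Finset.card_pos, Finset.card_sdiff_of_subset hTU]; omega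
    obtain ⟨d, hd, hdmax⟩ := Finset.exists_max_image (U \ T) a hne
    have hd' := Finset.mem_sdiff.1 hd
    refine ⟨insert d T, Finset.insert_subset hd'.1 hTU, by
      rw [Finset.card_insert_of_notMem hd'.2, hT], ?_⟩
    intro c hc b hb
    have hb' : b ∈ U \ T := by
      simp only [Finset.mem_sdiff, Finset.mem_insert, not_or] at hb ⊢
      exact ⟨hb.1, hb.2.2⟩
    rcases Finset.mem_insert.1 hc with rfl | hc
    · exact hdmax b hb'
    · exact hmax c hc b hb'

omit hp [Fintype β] in
-- What is left out is at most the minimum over T, hence at most the average. If U has fewer than S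
-- elements, T = U and nothing is left out.
lemma exists_largest_subset_avg (a : β → ℝ) (U : Finset β) {S : ℕ}
    (hS : 0 < S) :
    ∃ T ⊆ U, T.card ≤ S ∧ (U ≠ ∅ → T ≠ ∅) ∧ ∀ b ∈ U \ T, a b ≤ (∑ c ∈ T, a c) / S := by
  have hS' : (0 : ℝ) < S := by exact_mod_cast hS
  rcases le_total U.card S with h | h
  · exact ⟨U, subset_rfl, h, id, by simp⟩
  · obtain ⟨T, hTU, hT, hmax⟩ := exists_largest_subset a U S h
    refine ⟨T, hTU, hT.le, fun _ => Finset.card_pos.1 (hT ▸ hS) |>.ne_empty, fun b hb => ?_⟩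
    rw [le_div_iff₀ hS', mul_comm, ← hT, ← nsmul_eq_mul]
    exact Finset.card_nsmul_le_sum _ _ _ fun c hc => hmax c hc b hb

/-- A subadditive functional bounded by a multiple of the norm on `S`-sparse restrictions of `x` is
bounded on arbitrary restrictions through the mixed norm. -/
lemma subadditive_le_mixed (x : E) {N : Finset β → ℝ} {C : ℝ} (hC : 0 ≤ C) {S : ℕ} (hS : 0 < S)
    (hN : ∀ V W, Disjoint V W → N (V ∪ W) ≤ N V + N W) (U : Finset β)
    (hNC : ∀ V ⊆ U, V.card ≤ S → N V ≤ C * ‖p V x‖) {M : ℝ} (hM : 0 ≤ M)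
    (h : ∀ b ∈ U, ‖p {b} x‖ ≤ M) :
    N U ≤ C * (√S * M + (∑ b ∈ U, ‖p {b} x‖) / √S) := by
  induction U using Finset.strongInduction generalizing M with
  | H U ih =>
  rcases eq_or_ne U ∅ with rfl | hU
  · have h1 := hNC ∅ subset_rfl (by simp)
    rw [hp.empty, norm_zero, mul_zero] at h1
    exact h1.trans (by simp; positivity)
  -- The usual chain of pieces of S groups in decreasing order becomes a recursion: peel off the S
  -- largest groups T and pass their average on as the new bound M. Then √S times that average is
  -- the mixed norm of T over √S, so each piece is paid for by the one before it.
  obtain ⟨T, hTU, hTc, hTne, hT⟩ :=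
    exists_largest_subset_avg (fun b => ‖p {b} x‖) U hS
  have hsub : U \ T ⊂ U := Finset.sdiff_ssubset hTU (Finset.nonempty_iff_ne_empty.2 (hTne hU))
  have h1 := ih (U \ T) hsub (fun V hV => hNC V (hV.trans hsub.1)) (by positivity) hT
  have h2 : N T ≤ C * (√S * M) := (hNC T hTU hTc).trans <| by
    gcongr; exact hp.norm_le_sqrt_mul hTc x hM fun b hb => h b (hTU hb)
  have h3 := hN T (U \ T) Finset.disjoint_sdiff
  rw [Finset.union_sdiff_of_subset hTU] at h3
  have h4 := Finset.sum_sdiff (f := fun b => ‖p {b} x‖) hTU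
  have hS' : (0 : ℝ) < √S := Real.sqrt_pos.2 (by exact_mod_cast hS)
  have h5 : √S * ((∑ c ∈ T, ‖p {c} x‖) / S) = (∑ c ∈ T, ‖p {c} x‖) / √S := by
    nth_rw 2 [← Real.mul_self_sqrt (Nat.cast_nonneg S)]
    field_simp
  rw [h5] at h1
  calc N U ≤ N T + N (U \ T) := h3
    _ ≤ C * (√S * M) + C * ((∑ c ∈ T, ‖p {c} x‖) / √S + (∑ b ∈ U \ T, ‖p {b} x‖) / √S) := by
        gcongr
    _ = _ := by rw [← h4]; ring

/-! ## Basis pursuit denoising -/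

omit hp [Fintype β] [DecidableEq β] in
/-- The scalar inequality behind the error bound of basis pursuit denoising: `h₀` and `h₁` are the
error norms on the support and on the `S` largest remaining groups, `t` is the squared error norm
on the other groups, `w` the scaled mixed norm off the support. -/
lemma bpdn_scalar_bound {n a h₀ h₁ t w e σ ρ : ℝ} (hn : n ^ 2 = a ^ 2 + t)
    (ha : a ^ 2 = h₀ ^ 2 + h₁ ^ 2) (ha0 : 0 ≤ a) (hh₀ : 0 ≤ h₀) (hh₁ : 0 ≤ h₁) (he : 0 ≤ e)
    (hσ : 0 ≤ σ) (hρ0 : 0 ≤ ρ) (hρ1 : ρ < 1) (ht : t ≤ h₁ * w) (hw : w ≤ h₀ + 2 * e)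
    (haw : a ≤ σ + ρ * w) : n * (1 - ρ) ≤ 2 * σ + 2 * e := by
  have h0a : h₀ ≤ a := abs_le_of_sq_le_sq' (by nlinarith) ha0 |>.2
  have h1a : h₁ ≤ a := abs_le_of_sq_le_sq' (by nlinarith) ha0 |>.2
  obtain ⟨k, rfl⟩ : ∃ k, ρ = 1 - k := ⟨1 - ρ, by ring⟩
  have hk : 0 < k := by linarith
  have ha' : a ≤ σ + (1 - k) * (h₀ + 2 * e) := haw.trans (by gcongr)
  have ht' : t ≤ h₁ * (h₀ + 2 * e) := ht.trans (by gcongr)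
  have h0 : (1 - k) * h₀ ≤ (1 - k) * a := by gcongr
  rw [show 1 - (1 - k) = k by ring]
  refine abs_le_of_sq_le_sq' ?_ (by positivity) |>.2
  rw [mul_pow, hn]
  -- With k = 1 - ρ, the case ρ ≤ 1/2 allows the crude bounds h₀, h₁ ≤ a in the tail. For larger ρ
  -- the loss a - h₀ has to be kept, since h₁² = (a - h₀)(a + h₀) couples it to the tail.
  rcases le_total (1 / 2) k with hk2 | hk2
  · have hak : a * k ≤ σ + e := by nlinarith
    have h3 : h₁ * (h₀ + 2 * e) ≤ a * (a + 2 * e) := by gcongr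
    have hk1 : k ≤ 1 := by linarith
    have hke : k * e ≤ e := by nlinarith
    have h4 : (a * k) * (2 * (a * k) + 2 * (k * e)) ≤ (σ + e) * (2 * (σ + e) + 2 * e) := by
      gcongr
    have h5 : (a ^ 2 + t) * k ^ 2 ≤ (a ^ 2 + a * (a + 2 * e)) * k ^ 2 := by
      gcongr; linarith
    nlinarith [mul_nonneg hσ he, sq_nonneg σ]
  · set ρ := 1 - k with hρ
    have hρp : 0 < ρ := by linarith
    -- With Y = ρ(a - h₀) + 2ke + σ, it suffices to show k²n² + Y² ≤ (ka + Y)², that is, kt ≤ 2aY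
    -- when k > 0; the left side of this line is ka + Y.
    have hX : k * a + (ρ * (a - h₀) + 2 * k * e + σ) ≤ 2 * σ + 2 * e := by
      have : k * a = a - ρ * a := by rw [hρ]; ring
      have : k * e = e - ρ * e := by rw [hρ]; ring
      nlinarith
    have hd : 0 ≤ ρ * (a - h₀) := mul_nonneg hρ0 (by linarith)
    have hs : 0 ≤ ρ * (a - h₀) + 2 * k * e + σ := by positivity
    have h1 : (k * a + (ρ * (a - h₀) + 2 * k * e + σ)) ^ 2 ≤ (2 * σ + 2 * e) ^ 2 := by gcongr
    have h2 : ρ * h₁ ^ 2 ≤ 2 * a * (ρ * (a - h₀)) := by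
      have : h₁ ^ 2 = (a - h₀) * (a + h₀) := by linarith
      rw [this]
      nlinarith [mul_le_mul_of_nonneg_left h0a hd]
    have hka : k * a ≤ σ + 2 * ρ * e := by
      have : k * a = a - ρ * a := by rw [hρ]; ring
      nlinarith
    -- Complete the square in (ρh₁ - ka)² and bound the leftover k²a² through ka ≤ σ + 2ρe and k ≤
    -- ρ.
    have h3 : k * h₁ * a ≤ ρ * h₁ ^ 2 + a * (2 * k * e + 2 * σ) := by
      refine le_of_mul_le_mul_left ?_ hρp
      have h4 : a * k * (k * a - σ) ≤ a * k * (2 * ρ * e) := by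
        gcongr; linarith
      have h5 : a * k * σ ≤ a * ρ * σ := by gcongr; linarith
      have h6 : 0 ≤ a * ρ * σ := by positivity
      nlinarith [sq_nonneg (ρ * h₁ - k * a), mul_nonneg (mul_nonneg hρ0 hh₁) (mul_nonneg hk.le ha0)]
    have h4 : k * h₁ * h₀ ≤ k * h₁ * a := by gcongr
    have h5 : k * h₁ * e ≤ k * a * e := by gcongr
    have h6 : k * (h₁ * (h₀ + 2 * e)) ≤ 2 * a * (ρ * (a - h₀) + 2 * k * e + σ) := by nlinarith
    have h7 : t * k ^ 2 ≤ k * (2 * a * (ρ * (a - h₀) + 2 * k * e + σ)) := by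
      calc t * k ^ 2 ≤ (h₁ * (h₀ + 2 * e)) * k ^ 2 := by gcongr
        _ = k * (k * (h₁ * (h₀ + 2 * e))) := by ring
        _ ≤ _ := by gcongr
    generalize ρ * (a - h₀) + 2 * k * e + σ = Y at h1 h7
    have h8 : (a ^ 2 + t) * k ^ 2 + Y ^ 2 ≤ (k * a + Y) ^ 2 := by
      have : (k * a + Y) ^ 2 = a ^ 2 * k ^ 2 + k * (2 * a * Y) + Y ^ 2 := by ring
      rw [this]; linarith
    linarith [sq_nonneg Y]

omit hp in
/-- The cone condition for a vector whose mixed norm does not exceed that of `x`. -/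
lemma cone_condition {x xh : E} (A : Finset β)
    (hmin : ∑ b, ‖p {b} xh‖ ≤ ∑ b, ‖p {b} x‖) :
    ∑ b ∈ Aᶜ, ‖p {b} (xh - x)‖ ≤ ∑ b ∈ A, ‖p {b} (xh - x)‖ + 2 * ∑ b ∈ Aᶜ, ‖p {b} x‖ := by
  rw [← Finset.sum_add_sum_compl A, ← Finset.sum_add_sum_compl A] at hmin
  have h1 : ∑ b ∈ A, ‖p {b} x‖ ≤ ∑ b ∈ A, ‖p {b} (xh - x)‖ + ∑ b ∈ A, ‖p {b} xh‖ := by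
    rw [← Finset.sum_add_distrib]
    refine Finset.sum_le_sum fun b _ => ?_
    rw [map_sub, norm_sub_rev]
    linarith [norm_sub_norm_le (p {b} x) (p {b} xh)]
  have h2 : ∑ b ∈ Aᶜ, ‖p {b} (xh - x)‖ ≤ ∑ b ∈ Aᶜ, ‖p {b} xh‖ + ∑ b ∈ Aᶜ, ‖p {b} x‖ := by
    rw [← Finset.sum_add_distrib]
    refine Finset.sum_le_sum fun b _ => ?_
    rw [map_sub]
    exact norm_sub_le _ _
  linarith

/-- Error bound of group basis pursuit denoising under the group restricted isometry property. -/
theorem bpdn_error_bound {f : E →ₗ[ℝ] F} {S : ℕ} (hS : 0 < S) {δ : ℝ} (hδ0 : 0 ≤ δ)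
    (hδ1 : δ < √2 - 1) (hf : BlockRIP p f (2 * S) δ) {A : Finset β} (hA : A.card = S)
    {x xh : E} {y : F} {ε : ℝ} (hx : ‖f x - y‖ ≤ ε) (hxh : ‖f xh - y‖ ≤ ε)
    (hmin : ∑ b, ‖p {b} xh‖ ≤ ∑ b, ‖p {b} x‖) :
    ‖xh - x‖ ≤ c0 δ * ((∑ b ∈ Aᶜ, ‖p {b} x‖) / √S) + c1 δ * ε := by
  have hε : 0 ≤ ε := (norm_nonneg _).trans hx
  have hS' : (0 : ℝ) < √S := Real.sqrt_pos.2 (by exact_mod_cast hS)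
  have hSS : √(S : ℝ) * √S = S := Real.mul_self_sqrt (Nat.cast_nonneg S)
  have h2 : √(2 : ℝ) ^ 2 = 2 := Real.sq_sqrt (by norm_num)
  have h2p : 0 < √(2 : ℝ) := by positivity
  have h22 : √(2 : ℝ) < 2 := by nlinarith
  have hδ : δ < 1 := by linarith
  have hD : 0 < 1 - (1 + √2) * δ := by nlinarith
  have hcone := cone_condition A hmin
  set h := xh - x with hh
  set e := (∑ b ∈ Aᶜ, ‖p {b} x‖) / √S with he
  obtain ⟨T, hTA, hTc, -, hT⟩ :=
    exists_largest_subset_avg (fun b => ‖p {b} h‖) Aᶜ hS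
  set w := (∑ b ∈ Aᶜ, ‖p {b} h‖) / √S with hw
  have hd : Disjoint A T := (Finset.subset_compl_iff_disjoint_left.1 hTA)
  have hnn : ∀ V : Finset β, 0 ≤ ∑ b ∈ V, ‖p {b} h‖ := fun V => by positivity
  have hsplit := Finset.sum_sdiff (f := fun b => ‖p {b} h‖) hTA
  have hTsum : ∑ b ∈ T, ‖p {b} h‖ ≤ √S * ‖p T h‖ :=
    (hp.sum_le_sqrt_card T h).trans (by gcongr)
  have hcompl : (A ∪ T)ᶜ = Aᶜ \ T := by ext b; simp
  -- the tail beyond the `2S` leading groups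
  have htail : ‖p (A ∪ T)ᶜ h‖ ^ 2 ≤ ‖p T h‖ * w := by
    rw [hcompl, hp.norm_sq_eq_sum]
    calc ∑ b ∈ Aᶜ \ T, ‖p {b} h‖ ^ 2
        ≤ ∑ b ∈ Aᶜ \ T, ((∑ c ∈ T, ‖p {c} h‖) / S) * ‖p {b} h‖ := by
          refine Finset.sum_le_sum fun b hb => ?_
          rw [sq]; gcongr; exact hT b hb
      _ = ((∑ c ∈ T, ‖p {c} h‖) / S) * ∑ b ∈ Aᶜ \ T, ‖p {b} h‖ := by rw [Finset.mul_sum]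
      _ ≤ ((√S * ‖p T h‖) / S) * ∑ b ∈ Aᶜ, ‖p {b} h‖ := by
          refine mul_le_mul (by gcongr) (by linarith [hnn T]) (hnn _) (by positivity)
      _ = √S / S * (‖p T h‖ * ∑ b ∈ Aᶜ, ‖p {b} h‖) := by ring
      _ = ‖p T h‖ * w := by rw [hw, Real.sqrt_div_self]; ring
  -- The cone condition divided by √S, with Cauchy–Schwarz over the S groups of A.
  have hwle : w ≤ ‖p A h‖ + 2 * e := by
    have := hp.sum_le_sqrt_card A h
    rw [hA] at this
    rw [hw, he, div_le_iff₀ hS']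
    field_simp
    linarith
  have hnorm := hp.norm_sq_union hd h
  have hcard : (A ∪ T).card ≤ 2 * S := (Finset.card_union_le _ _).trans (by omega)
  set u := p (A ∪ T) h with hu
  have huu : p (A ∪ T) u = u := hp.self _ _
  -- Source of the √2 in the constants: near-orthogonality is applied to h on A and on T separately,
  -- since A ∪ T together with another S groups would exceed the order 2S.
  have hsum : ‖p A h‖ + ‖p T h‖ ≤ √2 * ‖u‖ := by
    refine abs_le_of_sq_le_sq' ?_ (by positivity) |>.2
    rw [mul_pow, h2, hnorm]; nlinarith [sq_nonneg (‖p A h‖ - ‖p T h‖)]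
  have hcross : |inner ℝ (f (p A h)) (f (p (A ∪ T)ᶜ h))| +
      |inner ℝ (f (p T h)) (f (p (A ∪ T)ᶜ h))| ≤ √2 * δ * ‖u‖ * w := by
    have := subadditive_le_mixed hp h
      (N := fun V => |inner ℝ (f (p A h)) (f (p V h))| + |inner ℝ (f (p T h)) (f (p V h))|)
      (C := √2 * δ * ‖u‖) (by positivity) hS
      (fun V W hVW => by
        simp only [hp.union _ _ _ hVW, map_add, inner_add_right]
        linarith [abs_add_le (inner ℝ (f (p A h)) (f (p V h))) (inner ℝ (f (p A h)) (f (p W h))),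
          abs_add_le (inner ℝ (f (p T h)) (f (p V h))) (inner ℝ (f (p T h)) (f (p W h)))])
      (Aᶜ \ T)
      (fun V hV hVS => by
        have hAV : Disjoint A V := Finset.subset_compl_iff_disjoint_left.1
          (hV.trans Finset.sdiff_subset)
        have hTV : Disjoint T V := Finset.disjoint_of_subset_right hV Finset.disjoint_sdiff
        have i1 := abs_inner_le_of_blockRIP hp hf hAV (by omega) (hp.self A h) (hp.self V h)
        have i2 := abs_inner_le_of_blockRIP hp hf hTV (by omega) (hp.self T h) (hp.self V h)
        calc _ ≤ δ * ‖p A h‖ * ‖p V h‖ + δ * ‖p T h‖ * ‖p V h‖ := add_le_add i1 i2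
          _ = (δ * ‖p V h‖) * (‖p A h‖ + ‖p T h‖) := by ring
          _ ≤ (δ * ‖p V h‖) * (√2 * ‖u‖) := by gcongr
          _ = _ := by ring)
      (M := (∑ c ∈ T, ‖p {c} h‖) / S) (by positivity) hT
    rw [hcompl]
    refine this.trans (le_of_eq ?_)
    congr 1
    rw [hw, ← hsplit]
    nth_rw 2 [← hSS]
    field_simp
    ring
  have hfh : ‖f h‖ ≤ 2 * ε := by
    have : f h = (f xh - y) - (f x - y) := by rw [hh, map_sub]; abel
    rw [this]; linarith [norm_sub_le (f xh - y) (f x - y)]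
  have hfu : ‖f u‖ ≤ √(1 + δ) * ‖u‖ :=
    norm_le_of_blockRIP hf (by positivity) (Real.sq_sqrt (by linarith)).ge hcard huu
  -- Expand ‖f u‖² = ⟨f u, f h⟩ - ⟨f u, f(h - u)⟩ and divide by ‖u‖.
  have hmain : (1 - δ) * ‖u‖ ≤ 2 * √(1 + δ) * ε + √2 * δ * w := by
    rcases (norm_nonneg u).eq_or_lt with h0 | h0
    · rw [← h0, mul_zero]
      have : 0 ≤ w := by positivity
      positivity
    refine le_of_mul_le_mul_right ?_ h0
    have e1 : f u = f h - f (p (A ∪ T)ᶜ h) := by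
      rw [← map_sub]; congr 1; rw [hu, eq_sub_iff_add_eq]; exact hp.compl _ _
    have e2 : ‖f u‖ ^ 2 = inner ℝ (f u) (f h) -
        (inner ℝ (f (p A h)) (f (p (A ∪ T)ᶜ h)) + inner ℝ (f (p T h)) (f (p (A ∪ T)ᶜ h))) := by
      rw [← inner_add_left, ← map_add, ← hp.union _ _ _ hd, ← hu, ← inner_sub_right, ← e1,
        real_inner_self_eq_norm_sq]
    have e3 : inner ℝ (f u) (f h) ≤ (√(1 + δ) * ‖u‖) * (2 * ε) :=
      (real_inner_le_norm _ _).trans (by gcongr)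
    have e4 := (hf _ hcard u huu).1
    have e5 := neg_abs_le (inner ℝ (f (p A h)) (f (p (A ∪ T)ᶜ h)))
    have e6 := neg_abs_le (inner ℝ (f (p T h)) (f (p (A ∪ T)ᶜ h)))
    nlinarith
  have hδ' : 0 < 1 - δ := by linarith
  have hρ1 : √2 * δ / (1 - δ) < 1 := by rw [div_lt_one hδ']; linarith
  have hfin := bpdn_scalar_bound (n := ‖h‖) (a := ‖u‖) (h₀ := ‖p A h‖) (h₁ := ‖p T h‖)
    (t := ‖p (A ∪ T)ᶜ h‖ ^ 2) (w := w) (e := e) (σ := 2 * √(1 + δ) * ε / (1 - δ))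
    (ρ := √2 * δ / (1 - δ)) (hp.norm_sq_compl _ _) hnorm (norm_nonneg _) (norm_nonneg _)
    (norm_nonneg _) (by positivity) (by positivity) (by positivity) hρ1 htail hwle (by
      rw [div_mul_eq_mul_div, ← add_div, le_div_iff₀ hδ']; linarith)
  have e1 : 1 - √2 * δ / (1 - δ) = (1 - (1 + √2) * δ) / (1 - δ) := by field_simp; ring
  rw [e1, mul_div_assoc', div_le_iff₀ hδ'] at hfin
  have e2 : (2 * (2 * √(1 + δ) * ε / (1 - δ)) + 2 * e) * (1 - δ) =
      4 * √(1 + δ) * ε + 2 * (1 - δ) * e := by field_simp; ring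
  rw [e2] at hfin
  calc ‖h‖ ≤ (4 * √(1 + δ) * ε + 2 * (1 - δ) * e) / (1 - (1 + √2) * δ) := by
        rwa [le_div_iff₀ hD]
    _ = c0 δ * e + c1 δ * ε := by rw [c0, c1]; ring

/-! ## Compressive sampling matching pursuit -/

/-- The part of the signal residual outside the groups identified by the proxy is small. -/
lemma identification_bound {f : E →ₗ[ℝ] F} {S : ℕ} (hf : BlockRIP p f (4 * S) 0.1)
    {s v : E} {e : F} {R Ω : Finset β} (hR : R.card ≤ 2 * S) (hs : p R s = s)
    (hv : ∀ z, inner ℝ v z = inner ℝ (f s + e) (f z)) (hΩ : Ω.card ≤ 2 * S)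
    (hbest : ‖p Ωᶜ v‖ ≤ ‖p Rᶜ v‖) :
    0.9 * ‖p Ωᶜ s‖ ≤ 0.2 * ‖s‖ + 2.1 * ‖e‖ := by
  have hd1 : Disjoint (Ω \ R) (Ω ∪ R)ᶜ := by
    rw [Finset.disjoint_left]; intro b; simp; tauto
  have hd2 : Disjoint (R \ Ω) (Ω ∪ R)ᶜ := by
    rw [Finset.disjoint_left]; intro b; simp; tauto
  have hu1 : (Ω \ R) ∪ (Ω ∪ R)ᶜ = Rᶜ := by ext b; simp; tauto
  have hu2 : (R \ Ω) ∪ (Ω ∪ R)ᶜ = Ωᶜ := by ext b; simp; tauto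
  have hc1 : (Ω \ R).card ≤ 2 * S := (Finset.card_le_card Finset.sdiff_subset).trans hΩ
  have hc2 : (R \ Ω).card ≤ 2 * S := (Finset.card_le_card Finset.sdiff_subset).trans hR
  have hc3 : (R ∩ Ω).card + (R \ Ω).card ≤ 4 * S := by
    rw [add_comm, Finset.card_sdiff_add_card_inter]; omega
  -- Cancel the part outside Ω ∪ R, common to both sides of the selection inequality. On Ω \ R the
  -- signal vanishes, so the proxy is small there; on R \ Ω the proxy controls the missed part of
  -- the signal.
  have hvv : ‖p (R \ Ω) v‖ ≤ ‖p (Ω \ R) v‖ := by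
    have n1 := hp.norm_sq_union hd1 v
    have n2 := hp.norm_sq_union hd2 v
    rw [hu1] at n1; rw [hu2] at n2
    have : ‖p Ωᶜ v‖ ^ 2 ≤ ‖p Rᶜ v‖ ^ 2 := by gcongr
    exact abs_le_of_sq_le_sq' (by linarith) (norm_nonneg _) |>.2
  have hsΩ : p Ωᶜ s = p (R \ Ω) s := by
    rw [← hs, hp.comp, hp.comp]; congr 2; ext b; simp; tauto
  -- The constant 1.05 satisfies 1.05² = 1.1025 ≥ 1 + 0.1.
  have hf1 : ∀ V : Finset β, V.card ≤ 2 * S → ∀ z, p V z = z → ‖f z‖ ≤ 1.05 * ‖z‖ :=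
    fun V hV z hz => norm_le_of_blockRIP hf (by norm_num) (by norm_num) (hV.trans (by omega)) hz
  have hq : ‖p (Ω \ R) v‖ ≤ 0.1 * ‖s‖ + 1.05 * ‖e‖ := by
    set q := p (Ω \ R) v with hq
    have hqq : p (Ω \ R) q = q := hp.self _ _
    rcases (norm_nonneg q).eq_or_lt with h0 | h0
    · rw [← h0]; positivity
    refine le_of_mul_le_mul_right ?_ h0
    have i1 : ‖q‖ ^ 2 = inner ℝ (f s) (f q) + inner ℝ e (f q) := by
      rw [← inner_add_left, ← hv, hq, hp.inner_self]
    have i2 := (le_abs_self _).trans (abs_inner_le_of_blockRIP hp hf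
      (Finset.disjoint_sdiff (s := R) (t := Ω)) (by omega) hs hqq)
    have i3 : inner ℝ e (f q) ≤ ‖e‖ * (1.05 * ‖q‖) :=
      (real_inner_le_norm _ _).trans (by gcongr; exact hf1 _ hc1 _ hqq)
    nlinarith
  rw [hsΩ]
  set r := p (R \ Ω) s with hr
  have hrr : p (R \ Ω) r = r := hp.self _ _
  rcases (norm_nonneg r).eq_or_lt with h0 | h0
  · rw [← h0, mul_zero]; positivity
  refine le_of_mul_le_mul_right ?_ h0
  have hsr : s = p (R ∩ Ω) s + r := by
    rw [hr, ← hp.union _ _ _ (Finset.disjoint_sdiff_inter R Ω).symm, Finset.union_comm,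
      Finset.sdiff_union_inter, hs]
  have i1 : ‖f r‖ ^ 2 = inner ℝ v r - inner ℝ e (f r) - inner ℝ (f (p (R ∩ Ω) s)) (f r) := by
    have : inner ℝ (f s) (f r) = inner ℝ (f (p (R ∩ Ω) s + r)) (f r) := by rw [← hsr]
    rw [hv, inner_add_left, this, map_add, inner_add_left, real_inner_self_eq_norm_sq]; ring
  have i2 := neg_le_of_abs_le (abs_inner_le_of_blockRIP hp hf
      (Finset.disjoint_sdiff_inter R Ω).symm hc3 (hp.self (R ∩ Ω) s) hrr)
  have i3 : -(‖e‖ * (1.05 * ‖r‖)) ≤ inner ℝ e (f r) :=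
    neg_le_of_abs_le ((abs_real_inner_le_norm _ _).trans (by gcongr; exact hf1 _ hc2 _ hrr))
  have i4 : inner ℝ v r ≤ ‖p (R \ Ω) v‖ * ‖r‖ := by
    have : inner ℝ v r = inner ℝ (p (R \ Ω) v) r := by rw [hp.symm, hrr]
    rw [this]; exact real_inner_le_norm _ _
  have i5 := (hf _ (hc2.trans (by omega)) r hrr).1
  have i6 : ‖p (R ∩ Ω) s‖ * ‖r‖ ≤ ‖s‖ * ‖r‖ := by gcongr; exact hp.norm_le _ _
  have i7 : ‖p (R \ Ω) v‖ * ‖r‖ ≤ (0.1 * ‖s‖ + 1.05 * ‖e‖) * ‖r‖ := by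
    gcongr; exact hvv.trans hq
  nlinarith

omit hp [Fintype β] [DecidableEq β] in
/-- The residual of a least squares problem on a set of blocks is orthogonal to the range. -/
lemma least_squares_orthogonal {f : E →ₗ[ℝ] F} {T : Finset β} {b : E} {y : F} (hb : p T b = b)
    (hmin : ∀ b', p T b' = b' → ‖y - f b‖ ≤ ‖y - f b'‖) {z : E} (hz : p T z = z) :
    inner ℝ (y - f b) (f z) = 0 := by
  refine eq_zero_of_quadratic_nonneg (a := ‖f z‖ ^ 2) (by positivity) fun t => ?_
  have h := hmin (b + t • z) (by rw [map_add, map_smul, hb, hz])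
  have h2 : ‖y - f b‖ ^ 2 ≤ ‖y - f (b + t • z)‖ ^ 2 := by gcongr
  rw [map_add, map_smul, ← sub_sub, norm_sub_sq_real (y - f b), inner_smul_right, norm_smul,
    mul_pow, Real.norm_eq_abs, sq_abs] at h2
  linarith

/-- Least squares on a set of blocks approximates a sparse signal. -/
lemma least_squares_bound {f : E →ₗ[ℝ] F} {S : ℕ} (hf : BlockRIP p f (4 * S) 0.1)
    {x b : E} {e : F} {A T : Finset β} (hA : A.card ≤ S) (hx : p A x = x) (hT : T.card ≤ 3 * S)
    (hb : p T b = b)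
    (hmin : ∀ b', p T b' = b' → ‖f x + e - f b‖ ≤ ‖f x + e - f b'‖) :
    0.9 * ‖x - b‖ ≤ ‖p Tᶜ x‖ + 1.05 * ‖e‖ := by
  set d := x - b with hd
  have hbT : p Tᶜ b = 0 := by
    rw [← hb, hp.comp, show Tᶜ ∩ T = ∅ by ext; simp, hp.empty]
  have hdT : p Tᶜ d = p Tᶜ x := by rw [hd, map_sub, hbT, sub_zero]
  have hdc : p (A \ T) (p Tᶜ x) = p Tᶜ x := by
    rw [← hx, hp.comp Tᶜ, hp.comp, show (A \ T) ∩ (Tᶜ ∩ A) = Tᶜ ∩ A by ext b; simp; tauto]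
  set u := p T d with hu
  have huu : p T u = u := hp.self _ _
  have hdsum : u + p Tᶜ x = d := by rw [← hdT]; exact hp.compl T d
  have key : 0.9 * ‖u‖ ≤ 0.1 * ‖p Tᶜ x‖ + 1.05 * ‖e‖ := by
    rcases (norm_nonneg u).eq_or_lt with h0 | h0
    · rw [← h0, mul_zero]; positivity
    refine le_of_mul_le_mul_right ?_ h0
    have horth := least_squares_orthogonal hb hmin huu
    have e1 : f x + e - f b = f u + f (p Tᶜ x) + e := by
      rw [← map_add, hdsum, hd, map_sub]; abel
    rw [e1, inner_add_left, inner_add_left, real_inner_self_eq_norm_sq] at horth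
    have i1 := (hf T (hT.trans (by omega)) u huu).1
    have i2 := neg_le_of_abs_le (abs_inner_le_of_blockRIP hp hf
      (Finset.sdiff_disjoint (s := T) (t := A))
      (by have := Finset.card_le_card (Finset.sdiff_subset (s := A) (t := T)); omega) hdc huu)
    have i3 : -(‖e‖ * (1.05 * ‖u‖)) ≤ inner ℝ e (f u) :=
      neg_le_of_abs_le ((abs_real_inner_le_norm _ _).trans (by
        gcongr
        exact norm_le_of_blockRIP hf (by norm_num) (by norm_num) (hT.trans (by omega)) huu))
    nlinarith
  have := norm_add_le u (p Tᶜ x)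
  rw [hdsum] at this
  linarith

/-- One iteration of group CoSaMP halves the error up to a multiple of the noise level. -/
theorem cosamp_step_bound {f : E →ₗ[ℝ] F} {S : ℕ} (hf : BlockRIP p f (4 * S) 0.1)
    {xA x x' b v : E} {e : F} {A X Ω : Finset β} (hA : A.card ≤ S) (hxA : p A xA = xA)
    (hX : X.card ≤ S) (hx : p X x = x)
    (hv : ∀ z, inner ℝ v z = inner ℝ (f xA + e - f x) (f z)) (hΩ : Ω.card ≤ 2 * S)
    (hbest : ∀ R : Finset β, R.card ≤ 2 * S → ‖p Ωᶜ v‖ ≤ ‖p Rᶜ v‖)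
    (hb : p (Ω ∪ X) b = b)
    (hmin : ∀ b', p (Ω ∪ X) b' = b' → ‖f xA + e - f b‖ ≤ ‖f xA + e - f b'‖)
    (hprune : ‖b - x'‖ ≤ ‖b - xA‖) :
    ‖xA - x'‖ ≤ 1 / 2 * ‖xA - x‖ + 7.55 * ‖e‖ := by
  have hAX : (A ∪ X).card ≤ 2 * S := (Finset.card_union_le _ _).trans (by omega)
  have h1 := identification_bound hp hf (s := xA - x) (v := v) (e := e) hAX
    (by rw [map_sub, hp.of_subset Finset.subset_union_left hxA,
      hp.of_subset Finset.subset_union_right hx])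
    (fun z => by rw [hv, map_sub]; congr 1; abel) hΩ (hbest _ hAX)
  have h2 := least_squares_bound hp hf hA hxA
    ((Finset.card_union_le Ω X).trans (by omega)) hb hmin
  have h3 : p (Ω ∪ X)ᶜ xA = p (Ω ∪ X)ᶜ (xA - x) := by
    have : p (Ω ∪ X)ᶜ x = 0 := by
      rw [← hx, hp.comp, show (Ω ∪ X)ᶜ ∩ X = ∅ by ext b; simp, hp.empty]
    rw [map_sub, this, sub_zero]
  have h4 : ‖p (Ω ∪ X)ᶜ (xA - x)‖ ≤ ‖p Ωᶜ (xA - x)‖ :=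
    hp.norm_le_of_subset (Finset.compl_subset_compl.2 Finset.subset_union_left) _
  rw [h3] at h2
  -- Pruning at most doubles the error of b, because xA is a competitor. The factors are then
  -- (2/0.9)(0.2/0.9) < 1/2 for the old error and (2/0.9)(2.1/0.9 + 1.05) < 7.55 for the noise.
  have h5 : ‖xA - x'‖ ≤ ‖xA - b‖ + ‖b - x'‖ := norm_sub_le_norm_sub_add_norm_sub _ _ _
  rw [norm_sub_rev b xA] at hprune
  have := norm_nonneg (xA - x)
  have := norm_nonneg e
  linarith

end Block

/-! ## The group decomposition of `ℂ^ι` -/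

section Mask

variable {ι ρ β : Type*} [Fintype ι] [Fintype ρ] [Fintype β] [DecidableEq β]

lemma l2norm_sq (v : ι → ℂ) : l2norm v ^ 2 = ∑ j, ‖v j‖ ^ 2 := by
  rw [l2norm, EuclideanSpace.norm_sq_eq]

lemma l2norm_nonneg (v : ι → ℂ) : 0 ≤ l2norm v := norm_nonneg _

lemma l2norm_sub_comm (v w : ι → ℂ) : l2norm (v - w) = l2norm (w - v) := by
  rw [l2norm, WithLp.toLp_sub, norm_sub_rev, ← WithLp.toLp_sub, l2norm]

/-- Restriction to the groups with label in `V`, with zeros elsewhere. -/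
def mask (g : ι → β) (V : Finset β) : EuclideanSpace ℂ ι →ₗ[ℝ] EuclideanSpace ℂ ι where
  toFun x := WithLp.toLp 2 fun j => if g j ∈ V then x j else 0
  map_add' x y := by ext j; simp only [PiLp.add_apply]; split_ifs <;> simp
  map_smul' c x := by
    ext j; simp only [PiLp.smul_apply, RingHom.id_apply]; split_ifs <;> simp

omit [Fintype β] [Fintype ι] in
lemma mask_apply (g : ι → β) (V : Finset β) (x : EuclideanSpace ℂ ι) (j : ι) :
    mask g V x j = if g j ∈ V then x j else 0 := rfl

lemma real_inner_euclidean (x y : EuclideanSpace ℂ ι) :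
    inner ℝ x y = (∑ j, inner ℂ (x j) (y j)).re := by
  rw [PiLp.inner_apply, Complex.re_sum]; rfl

lemma isBlockProj_mask (g : ι → β) : IsBlockProj (mask g) where
  comp V W x := by
    ext j; simp only [mask_apply, Finset.mem_inter]; split_ifs <;> simp_all
  symm V x y := by
    rw [real_inner_euclidean, real_inner_euclidean]
    congr 1
    refine Finset.sum_congr rfl fun j _ => ?_
    simp only [mask_apply]; split_ifs <;> simp
  union V W x h := by
    ext j
    have hVW : g j ∈ V → g j ∉ W := fun hV => Finset.disjoint_left.1 h hV
    simp only [mask_apply, PiLp.add_apply, Finset.mem_union]; split_ifs <;> simp_all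
  univ x := by ext j; simp [mask_apply]

omit [Fintype β] in
lemma l2norm_subvec_sq (g : ι → β) (x : ι → ℂ) (b : β) :
    l2norm (subvec g x b) ^ 2 = ∑ j with g j = b, ‖x j‖ ^ 2 := by
  rw [l2norm_sq, Finset.sum_subtype (Finset.univ.filter fun j => g j = b) (p := fun j => g j = b)
    (by simp) (fun j => ‖x j‖ ^ 2)]
  rfl

omit [Fintype β] in
lemma norm_mask_singleton (g : ι → β) (x : ι → ℂ) (b : β) :
    ‖mask g {b} (WithLp.toLp 2 x)‖ = l2norm (subvec g x b) := by
  have h : ‖mask g {b} (WithLp.toLp 2 x)‖ ^ 2 = l2norm (subvec g x b) ^ 2 := by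
    rw [EuclideanSpace.norm_sq_eq, l2norm_subvec_sq, Finset.sum_filter]
    simp only [mask_apply, Finset.mem_singleton]
    refine Finset.sum_congr rfl fun j _ => ?_
    split_ifs <;> simp
  exact (pow_left_inj₀ (norm_nonneg _) (l2norm_nonneg _) two_ne_zero).1 h

lemma mixedNorm_eq (g : ι → β) (x : ι → ℂ) :
    mixedNorm g x = ∑ b, ‖mask g {b} (WithLp.toLp 2 x)‖ := by
  simp only [mixedNorm, norm_mask_singleton]

omit [Fintype β] [Fintype ι] in
lemma mask_eq_self_iff (g : ι → β) (V : Finset β) (x : EuclideanSpace ℂ ι) :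
    mask g V x = x ↔ groupSupp g x.ofLp ⊆ V := by
  constructor
  · intro h b hb
    by_contra hbV
    refine hb (funext fun j => ?_)
    have := congrArg (fun z : EuclideanSpace ℂ ι => z j) h
    simp only [mask_apply, j.2, Finset.mem_coe.not.1 hbV, if_false] at this
    exact this.symm
  · intro h
    ext j
    rw [mask_apply]
    split_ifs with hj
    · rfl
    · by_contra hne
      exact hj (h (a := g j) fun h0 => hne (congrFun h0 ⟨j, rfl⟩).symm)

/-- The group support as a finite set. -/
def suppFinset (g : ι → β) (x : ι → ℂ) : Finset β := (Set.toFinite (groupSupp g x)).toFinset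

omit [Fintype ι] [DecidableEq β] in
lemma coe_suppFinset (g : ι → β) (x : ι → ℂ) : (suppFinset g x : Set β) = groupSupp g x := by
  simp [suppFinset]

omit [Fintype ι] [DecidableEq β] in
lemma groupSparse_iff_card (g : ι → β) (S : ℕ) (x : ι → ℂ) :
    GroupSparse g S x ↔ (suppFinset g x).card ≤ S := by
  rw [GroupSparse, ← coe_suppFinset, Set.ncard_coe_finset]

omit [Fintype ι] in
lemma mask_suppFinset (g : ι → β) (x : EuclideanSpace ℂ ι) :
    mask g (suppFinset g x.ofLp) x = x := by
  rw [mask_eq_self_iff, coe_suppFinset]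

omit [Fintype ι] in
lemma groupSparse_of_mask {g : ι → β} {S : ℕ} {V : Finset β} (hV : V.card ≤ S)
    {x : EuclideanSpace ℂ ι} (hx : mask g V x = x) : GroupSparse g S x.ofLp := by
  rw [groupSparse_iff_card]
  refine (Finset.card_le_card ?_).trans hV
  rw [← Finset.coe_subset, coe_suppFinset]
  exact (mask_eq_self_iff g V x).1 hx

/-- The real-linear map between Euclidean spaces given by a complex matrix. -/
def matMap (Φ : Matrix ρ ι ℂ) : EuclideanSpace ℂ ι →ₗ[ℝ] EuclideanSpace ℂ ρ where
  toFun x := WithLp.toLp 2 (Φ *ᵥ x.ofLp)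
  map_add' x y := by simp [Matrix.mulVec_add]
  map_smul' c x := by simp [Matrix.mulVec_smul]

lemma inner_conjTranspose_mulVec (Φ : Matrix ρ ι ℂ) (r : EuclideanSpace ℂ ρ)
    (z : EuclideanSpace ℂ ι) :
    inner ℝ (WithLp.toLp 2 (Φᴴ *ᵥ r.ofLp)) z = inner ℝ r (matMap Φ z) := by
  rw [real_inner_euclidean, real_inner_euclidean]
  congr 1
  simp only [matMap, LinearMap.coe_mk, AddHom.coe_mk, RCLike.inner_apply]
  change z.ofLp ⬝ᵥ star (Φᴴ *ᵥ r.ofLp) = (Φ *ᵥ z.ofLp) ⬝ᵥ star r.ofLp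
  rw [Matrix.star_mulVec, Matrix.conjTranspose_conjTranspose, dotProduct_comm,
    ← Matrix.dotProduct_mulVec, dotProduct_comm]

/-! ### Restricted isometry constants and block-diagonal stacking -/

lemma blockRIP_of_gRIPWith {g : ι → β} {n : ℕ} {Φ : Matrix ρ ι ℂ} {δ : ℝ}
    (h : GRIPWith g n Φ δ) : BlockRIP (mask g) (matMap Φ) n δ :=
  fun _ hV x hx => h x.ofLp (groupSparse_of_mask hV hx)

omit [DecidableEq β] [Fintype β] in
lemma GRIPWith.mono {g : ι → β} {n : ℕ} {Φ : Matrix ρ ι ℂ} {δ δ' : ℝ}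
    (h : GRIPWith g n Φ δ) (hδ : δ ≤ δ') : GRIPWith g n Φ δ' := fun x hx =>
  ⟨le_trans (by gcongr) (h x hx).1, (h x hx).2.trans (by gcongr)⟩

omit [DecidableEq β] [Fintype β] in
lemma gRIC_nonneg (g : ι → β) (n : ℕ) (Φ : Matrix ρ ι ℂ) : 0 ≤ gRIC g n Φ :=
  Real.sInf_nonneg fun _ h => h.1

omit [DecidableEq β] [Fintype β] in
lemma gRIC_le {g : ι → β} {n : ℕ} {Φ : Matrix ρ ι ℂ} {δ : ℝ} (hδ : 0 ≤ δ)
    (h : GRIPWith g n Φ δ) : gRIC g n Φ ≤ δ :=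
  csInf_le ⟨0, fun _ h => h.1⟩ ⟨hδ, h⟩

omit [DecidableEq β] [Fintype β] in
/-- The infimum that defines the restricted isometry constant is attained. -/
lemma gRIPWith_gRIC {g : ι → β} {n : ℕ} {Φ : Matrix ρ ι ℂ} {δ : ℝ} (hδ : 0 ≤ δ)
    (h : GRIPWith g n Φ δ) : GRIPWith g n Φ (gRIC g n Φ) := by
  intro x hx
  have key : ∀ η > 0, GRIPWith g n Φ (gRIC g n Φ + η) := fun η hη => by
    obtain ⟨d, hd, hlt⟩ := exists_lt_of_csInf_lt (s := {δ : ℝ | 0 ≤ δ ∧ GRIPWith g n Φ δ})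
      ⟨δ, hδ, h⟩ (lt_add_of_pos_right (gRIC g n Φ) hη)
    exact hd.2.mono hlt.le
  have hx2 : 0 ≤ l2norm x ^ 2 := sq_nonneg _
  constructor <;> refine le_of_forall_pos_le_add fun η hη => ?_
  all_goals
    have hη' : 0 < η / (l2norm x ^ 2 + 1) := by positivity
    have h1 := key _ hη' x hx
    have h2 : η / (l2norm x ^ 2 + 1) * l2norm x ^ 2 ≤ η := by
      rw [div_mul_eq_mul_div, div_le_iff₀ (by positivity)]; nlinarith
    linarith [h1.1, h1.2]

omit [DecidableEq β] [Fintype β] in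
lemma HasGRIP.gRIPWith_gRIC {g : ι → β} {n : ℕ} {Φ : Matrix ρ ι ℂ} (h : HasGRIP g n Φ) :
    GRIPWith g n Φ (gRIC g n Φ) :=
  let ⟨_, h0, _, h1⟩ := h
  MGCS.gRIPWith_gRIC h0.le h1

omit [DecidableEq β] in
/-- A block diagonal matrix inherits the restricted isometry property of its blocks with respect to
the stacked partition. -/
lemma gRIPWith_blockDiagonal {o : Type*} [Fintype o] [DecidableEq o] {g : ι → β} {n : ℕ}
    {Φ : o → Matrix ρ ι ℂ} {δ : ℝ} (h : ∀ θ, GRIPWith g n (Φ θ) δ) :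
    GRIPWith (fun jθ : ι × o => g jθ.1) n (Matrix.blockDiagonal Φ) δ := by
  intro x hx
  have hx1 : l2norm x ^ 2 = ∑ θ, l2norm (fun j => x (j, θ)) ^ 2 := by
    simp only [l2norm_sq, Fintype.sum_prod_type_right]
  have hx2 : l2norm (Matrix.blockDiagonal Φ *ᵥ x) ^ 2 =
      ∑ θ, l2norm (Φ θ *ᵥ fun j => x (j, θ)) ^ 2 := by
    simp only [l2norm_sq, Fintype.sum_prod_type_right]
    refine Finset.sum_congr rfl fun θ _ => Finset.sum_congr rfl fun q _ => ?_
    congr 2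
    simp only [Matrix.mulVec, dotProduct, Fintype.sum_prod_type, Matrix.blockDiagonal_apply,
      ite_mul, zero_mul, Finset.sum_ite_eq, Finset.mem_univ, if_true]
  -- A group active in one slice is active in the stacked vector, because the stacked groups collect
  -- all channels.
  have hs : ∀ θ, GroupSparse g n fun j => x (j, θ) := fun θ => by
    refine (Set.ncard_le_ncard ?_ (Set.toFinite _)).trans hx
    intro b hb h0
    exact hb (funext fun j => congrFun h0 ⟨(j, θ), j.2⟩)
  rw [hx1, hx2, Finset.mul_sum, Finset.mul_sum]
  exact ⟨Finset.sum_le_sum fun θ _ => (h θ _ (hs θ)).1,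
    Finset.sum_le_sum fun θ _ => (h θ _ (hs θ)).2⟩

/-! ### Recovery guarantees for complex vectors -/

/-- Error bound of group basis pursuit denoising. -/
theorem IsGBPDNSolution.error_bound {g : ι → β} {Φ : Matrix ρ ι ℂ} {y : ρ → ℂ} {ε δ : ℝ}
    {x xh : ι → ℂ} (hxh : IsGBPDNSolution g Φ y ε xh) (hx : l2norm (Φ *ᵥ x - y) ≤ ε)
    {S : ℕ} (hS : 0 < S) (hδ0 : 0 ≤ δ) (hδ1 : δ < √2 - 1) (hΦ : GRIPWith g (2 * S) Φ δ)
    {A : Finset β} (hA : A.card = S) :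
    l2norm (xh - x) ≤ c0 δ * ((∑ b ∈ Aᶜ, l2norm (subvec g x b)) / √S) + c1 δ * ε := by
  have h := hxh.2 x hx
  rw [mixedNorm_eq, mixedNorm_eq] at h
  simp only [← norm_mask_singleton]
  exact bpdn_error_bound (isBlockProj_mask g) hS hδ0 hδ1 (blockRIP_of_gRIPWith hΦ) hA
    (y := WithLp.toLp 2 y) hx hxh.1 h

/-- Restricting v to the groups in R is an admissible competitor, and w vanishes off its own
support. Only this consequence of best approximation is needed to identify groups, so the breaking
of ties plays no role. -/
lemma IsBestGroupApprox.norm_compl_le {g : ι → β} {n : ℕ} {v w : ι → ℂ}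
    (h : IsBestGroupApprox g n v w) {R : Finset β} (hR : R.card ≤ n) :
    ‖mask g (suppFinset g w)ᶜ (WithLp.toLp 2 v)‖ ≤ ‖mask g Rᶜ (WithLp.toLp 2 v)‖ := by
  have hp := isBlockProj_mask g
  set V : EuclideanSpace ℂ ι := WithLp.toLp 2 v
  set W : EuclideanSpace ℂ ι := WithLp.toLp 2 w
  have hW : mask g (suppFinset g w) W = W := mask_suppFinset g W
  have h1 : ‖V - W‖ ≤ ‖V - mask g R V‖ :=
    h.2 (mask g R V).ofLp (groupSparse_of_mask hR (hp.self R V))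
  have h2 : V - mask g R V = mask g Rᶜ V := by rw [sub_eq_iff_eq_add']; exact (hp.compl R V).symm
  have h3 : mask g (suppFinset g w)ᶜ V = mask g (suppFinset g w)ᶜ (V - W) := by
    rw [map_sub, ← hW, hp.comp, show (suppFinset g w)ᶜ ∩ suppFinset g w = ∅ by ext; simp,
      hp.empty, sub_zero]
  rw [h3, ← h2]
  exact (hp.norm_le _ _).trans h1

/-- The noise is taken to be y - Φ xA, so no measurement model is assumed and xA may be any group
S-sparse vector. Sparsity of the new iterate is carried along to allow induction. -/
lemma IsGCoSaMPStep.error_bound {g : ι → β} {S : ℕ} {Φ : Matrix ρ ι ℂ} {y : ρ → ℂ}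
    {x x' xA : ι → ℂ} (h : IsGCoSaMPStep g S Φ y x x') (hΦ : GRIPWith g (4 * S) Φ 0.1)
    (hx : GroupSparse g S x) (hxA : GroupSparse g S xA) :
    GroupSparse g S x' ∧
      l2norm (xA - x') ≤ 1 / 2 * l2norm (xA - x) + 7.55 * l2norm (y - Φ *ᵥ xA) := by
  obtain ⟨w, b, hw, hb, hx'⟩ := h
  refine ⟨hx'.1, ?_⟩
  have hp := isBlockProj_mask g
  have hT : (((suppFinset g w ∪ suppFinset g x : Finset β)) : Set β) =
      groupSupp g w ∪ groupSupp g x := by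
    rw [Finset.coe_union, coe_suppFinset, coe_suppFinset]
  have hy : ∀ z : ρ → ℂ, Φ *ᵥ xA + (y - Φ *ᵥ xA) - z = y - z := fun z => by abel
  refine cosamp_step_bound hp (f := matMap Φ) (blockRIP_of_gRIPWith hΦ)
    (xA := WithLp.toLp 2 xA) (x := WithLp.toLp 2 x) (x' := WithLp.toLp 2 x')
    (b := WithLp.toLp 2 b) (v := WithLp.toLp 2 (Φᴴ *ᵥ (y - Φ *ᵥ x)))
    (e := WithLp.toLp 2 (y - Φ *ᵥ xA)) (A := suppFinset g xA) (X := suppFinset g x)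
    (Ω := suppFinset g w) ((groupSparse_iff_card _ _ _).1 hxA) (mask_suppFinset g _)
    ((groupSparse_iff_card _ _ _).1 hx) (mask_suppFinset g _) (fun z => ?_)
    ((groupSparse_iff_card _ _ _).1 hw.1) (fun R hR => hw.norm_compl_le hR) ?_
    (fun b' hb' => ?_) (hx'.2 xA hxA)
  · rw [inner_conjTranspose_mulVec Φ (WithLp.toLp 2 (y - Φ *ᵥ x))]
    congr 1
    exact congrArg (WithLp.toLp 2) (hy (Φ *ᵥ x)).symm
  · rw [mask_eq_self_iff, hT]; exact hb.1
  · rw [mask_eq_self_iff, hT] at hb'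
    have h1 := hb.2 b'.ofLp hb'
    rw [← hy, ← hy (Φ *ᵥ b'.ofLp)] at h1
    exact h1

/-- The noise constant is the fixed point of the recursion: 15.1 / 2 + 7.55 = 15.1. -/
lemma IsGCoSaMPIterate.sparse_error_bound {g : ι → β} {S : ℕ} {Φ : Matrix ρ ι ℂ} {y : ρ → ℂ}
    {n : ℕ} {xh xA : ι → ℂ} (h : IsGCoSaMPIterate g S Φ y n xh)
    (hΦ : GRIPWith g (4 * S) Φ 0.1) (hxA : GroupSparse g S xA) :
    GroupSparse g S xh ∧
      l2norm (xA - xh) ≤ 1 / 2 ^ n * l2norm xA + 15.1 * l2norm (y - Φ *ᵥ xA) := by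
  induction h with
  | zero =>
    refine ⟨?_, ?_⟩
    · have : groupSupp g (0 : ι → ℂ) = ∅ := by
        ext b; simp only [groupSupp, Set.mem_ofPred_eq, Set.mem_empty_iff_false, iff_false, not_not]
        rfl
      rw [GroupSparse, this]; simp
    · have := l2norm_nonneg (y - Φ *ᵥ xA)
      simp only [sub_zero, pow_zero]
      linarith
  | succ h hs ih =>
    obtain ⟨h1, h2⟩ := hs.error_bound hΦ ih.1 hxA
    refine ⟨h1, ?_⟩
    rw [pow_succ, one_div, mul_inv, ← one_div]
    linarith [ih.2]

/-- Error bound of group CoSaMP for a signal that is not necessarily group sparse. -/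
theorem IsGCoSaMPIterate.error_bound {g : ι → β} {S : ℕ} (hS : 0 < S) {Φ : Matrix ρ ι ℂ}
    {y : ρ → ℂ} {n : ℕ} {x xh : ι → ℂ} (h : IsGCoSaMPIterate g S Φ y n xh)
    (hΦ : GRIPWith g (4 * S) Φ 0.1) {ε : ℝ} (hx : l2norm (Φ *ᵥ x - y) ≤ ε) {A : Finset β}
    (hA : A.card = S) :
    l2norm (xh - x) ≤ 20 * (1 + 1 / √S) * (∑ b ∈ Aᶜ, l2norm (subvec g x b)) + 20 * ε +
      1 / 2 ^ n * l2norm x := by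
  have hp := isBlockProj_mask g
  set X : EuclideanSpace ℂ ι := WithLp.toLp 2 x with hX
  set XA := mask g A X with hXA
  set leak := ∑ b ∈ Aᶜ, l2norm (subvec g x b) with hleak
  have hleak' : leak = ∑ b ∈ Aᶜ, ‖mask g {b} X‖ := by
    rw [hleak]; exact Finset.sum_congr rfl fun b _ => (norm_mask_singleton g x b).symm
  have hleak0 : 0 ≤ leak := by rw [hleak']; positivity
  have hcompl : X = XA + mask g Aᶜ X := (hp.compl A X).symm
  have htail : ‖mask g Aᶜ X‖ ≤ leak := by rw [hleak']; exact hp.norm_le_sum _ _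
  have hf := blockRIP_of_gRIPWith hΦ
  -- The tail need not be sparse, but each single group is, so the RIP applies group by group. The
  -- final leakage constant is then 15.1 · 1.05 + 1 < 20, even without the 1/√S term.
  have hftail : ‖matMap Φ (mask g Aᶜ X)‖ ≤ 1.05 * leak := by
    rw [hp.eq_sum, map_sum, hleak', Finset.mul_sum]
    refine (norm_sum_le _ _).trans (Finset.sum_le_sum fun b _ => ?_)
    exact norm_le_of_blockRIP hf (by norm_num) (by norm_num)
      (by rw [Finset.card_singleton]; omega) (hp.self {b} X)
  have h1 : ‖XA - WithLp.toLp 2 xh‖ ≤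
      1 / 2 ^ n * ‖XA‖ + 15.1 * ‖WithLp.toLp 2 y - matMap Φ XA‖ :=
    (h.sparse_error_bound hΦ (xA := XA.ofLp) (groupSparse_of_mask hA.le (hp.self A X))).2
  have h2 : ‖WithLp.toLp 2 y - matMap Φ XA‖ ≤ ε + 1.05 * leak := by
    have e1 : WithLp.toLp 2 y - matMap Φ XA =
        matMap Φ (mask g Aᶜ X) - (matMap Φ X - WithLp.toLp 2 y) := by
      nth_rw 2 [hcompl]; rw [map_add]; abel
    have e2 : ‖matMap Φ X - WithLp.toLp 2 y‖ ≤ ε := hx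
    rw [e1]
    linarith [norm_sub_le (matMap Φ (mask g Aᶜ X)) (matMap Φ X - WithLp.toLp 2 y)]
  have h3 : ‖WithLp.toLp 2 xh - X‖ ≤ ‖XA - WithLp.toLp 2 xh‖ + ‖mask g Aᶜ X‖ := by
    have e1 : WithLp.toLp 2 xh - X = -(XA - WithLp.toLp 2 xh) - mask g Aᶜ X := by
      nth_rw 1 [hcompl]; abel
    rw [e1]
    exact (norm_sub_le _ _).trans (by rw [norm_neg])
  have h4 : 1 / 2 ^ n * ‖XA‖ ≤ 1 / 2 ^ n * l2norm x := by gcongr; exact hp.norm_le _ _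
  have h5 : 0 ≤ 20 * (1 / √(S : ℝ)) * leak := by positivity
  have h6 : 0 ≤ ε := (norm_nonneg _).trans hx
  change ‖WithLp.toLp 2 xh - X‖ ≤ _
  linarith

end Mask

/-! ## The discrete Fourier transform -/

/-- The discrete Fourier kernel of period `n`. -/
def fourierKernel (n : ℕ) (a b : ℤ) : ℂ := Complex.exp (2 * Real.pi * Complex.I * (a * b / n))

lemma fourierKernel_comm (n : ℕ) (a b : ℤ) : fourierKernel n a b = fourierKernel n b a := by
  rw [fourierKernel, fourierKernel, mul_comm (a : ℂ)]

lemma fourierKernel_add_right (n : ℕ) (a b c : ℤ) :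
    fourierKernel n a (b + c) = fourierKernel n a b * fourierKernel n a c := by
  rw [fourierKernel, fourierKernel, fourierKernel, ← Complex.exp_add]
  congr 1; push_cast; ring

lemma fourierKernel_add_left (n : ℕ) (a b c : ℤ) :
    fourierKernel n (a + b) c = fourierKernel n a c * fourierKernel n b c := by
  simp only [fourierKernel_comm n _ c, fourierKernel_add_right]

lemma conj_fourierKernel (n : ℕ) (a b : ℤ) :
    star (fourierKernel n a b) = fourierKernel n (-a) b := by
  rw [fourierKernel, fourierKernel, Complex.star_def, ← Complex.exp_conj]
  congr 1
  simp only [map_mul, map_div₀, map_ofNat, Complex.conj_ofReal, Complex.conj_I, map_intCast,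
    map_natCast, Int.cast_neg]
  ring

lemma fourierKernel_of_dvd {n : ℕ} (hn : 0 < n) {a : ℤ} (h : (n : ℤ) ∣ a) (b : ℤ) :
    fourierKernel n a b = 1 := by
  obtain ⟨c, rfl⟩ := h
  have hn' : (n : ℂ) ≠ 0 := by exact_mod_cast hn.ne'
  rw [fourierKernel, Complex.exp_eq_one_iff]
  refine ⟨c * b, ?_⟩
  push_cast; field_simp

lemma fourierKernel_natCast (n : ℕ) (a : ℤ) (t : ℕ) :
    fourierKernel n a t = fourierKernel n a 1 ^ t := by
  rw [fourierKernel, fourierKernel, ← Complex.exp_nat_mul]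
  congr 1; push_cast; ring

/-- Sampling with step N/n turns the kernel of period N into that of period n; this makes the
subsampled channel a small DFT. -/
lemma fourierKernel_mul_left {n N : ℕ} (hN : 0 < N) (h : n ∣ N) (a b : ℤ) :
    fourierKernel N (a * (N / n : ℕ)) b = fourierKernel n a b := by
  obtain ⟨k, rfl⟩ := h
  have hn : 0 < n := Nat.pos_of_mul_pos_right hN
  have hk : 0 < k := Nat.pos_of_mul_pos_left hN
  have hn' : (n : ℂ) ≠ 0 := by exact_mod_cast hn.ne'
  have hk' : (k : ℂ) ≠ 0 := by exact_mod_cast hk.ne'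
  rw [Nat.mul_div_cancel_left _ hn, fourierKernel, fourierKernel]
  congr 1; push_cast; field_simp

lemma sum_range_fourierKernel {n : ℕ} (hn : 0 < n) (a : ℤ) :
    ∑ t ∈ Finset.range n, fourierKernel n a t = if (n : ℤ) ∣ a then (n : ℂ) else 0 := by
  split_ifs with h
  · simp [fourierKernel_of_dvd hn h]
  · have hn' : (n : ℂ) ≠ 0 := by exact_mod_cast hn.ne'
    have h1 : fourierKernel n a 1 ≠ 1 := fun h1 => by
      rw [fourierKernel, Complex.exp_eq_one_iff] at h1
      obtain ⟨c, hc⟩ := h1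
      have h2 : (2 * Real.pi * Complex.I : ℂ) ≠ 0 := Complex.two_pi_I_ne_zero
      rw [mul_comm (c : ℂ)] at hc
      have h3 := mul_left_cancel₀ h2 hc
      rw [Int.cast_one, mul_one, div_eq_iff hn'] at h3
      exact h ⟨c, by rw [mul_comm]; exact_mod_cast h3⟩
    have h2 : fourierKernel n a 1 ^ n = 1 := by
      rw [← fourierKernel_natCast, fourierKernel_comm]
      exact fourierKernel_of_dvd hn dvd_rfl a
    simp only [fourierKernel_natCast]
    rw [geom_sum_eq h1, h2, sub_self, zero_div]

/-- For even n the symmetric range has exactly n elements, a full period; for odd n it would miss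
one. -/
lemma sum_dopplerRange {n : ℕ} (hn : Even n) (f : ℤ → ℂ) :
    ∑ i ∈ MIMOSystem.dopplerRange n, f i =
      ∑ t ∈ Finset.range n, f ((t : ℤ) + -((n / 2 : ℕ) : ℤ)) := by
  obtain ⟨k, rfl⟩ := hn
  symm
  refine Finset.sum_bij (fun t _ => (t : ℤ) + -(((k + k) / 2 : ℕ) : ℤ)) ?_ ?_ ?_ ?_
  · intro t ht
    simp only [MIMOSystem.dopplerRange, Finset.mem_Ico, Finset.mem_range] at ht ⊢
    omega
  · intro a _ b _ h
    omega
  · intro i hi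
    simp only [MIMOSystem.dopplerRange, Finset.mem_Ico] at hi
    refine ⟨(i + ((k + k) / 2 : ℕ)).toNat, ?_, ?_⟩
    · simp only [Finset.mem_range]; omega
    · omega
  · intros; rfl

lemma sum_dopplerRange_fourierKernel {n : ℕ} (hn : 0 < n) (he : Even n) (a : ℤ) :
    ∑ i ∈ MIMOSystem.dopplerRange n, fourierKernel n a i =
      if (n : ℤ) ∣ a then (n : ℂ) else 0 := by
  rw [sum_dopplerRange he]
  simp only [fourierKernel_add_right]
  rw [← Finset.sum_mul, sum_range_fourierKernel hn]
  split_ifs with h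
  · rw [fourierKernel_of_dvd hn h, mul_one]
  · rw [zero_mul]

/-! ### Inversion and Parseval for orthogonal kernels -/

/-- The columns `e · i`, `i ∈ s`, of a kernel are orthogonal on `t` with squared norm `N`. -/
def OrthogonalKernel {κ ι : Type*} [DecidableEq ι] (t : Finset κ) (s : Finset ι) (e : κ → ι → ℂ)
    (N : ℕ) : Prop :=
  ∀ i ∈ s, ∀ j ∈ s, ∑ l ∈ t, star (e l i) * e l j = if i = j then (N : ℂ) else 0

section OrthogonalKernel

variable {κ ι κ' ι' : Type*} [DecidableEq ι] [DecidableEq ι'] {t : Finset κ} {s : Finset ι}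
  {e : κ → ι → ℂ} {t' : Finset κ'} {s' : Finset ι'} {e' : κ' → ι' → ℂ} {N N' : ℕ}

lemma OrthogonalKernel.inversion (h : OrthogonalKernel t s e N) (x : ι → ℂ) {i : ι}
    (hi : i ∈ s) : ∑ l ∈ t, star (e l i) * ∑ j ∈ s, e l j * x j = N * x i := by
  calc ∑ l ∈ t, star (e l i) * ∑ j ∈ s, e l j * x j
      = ∑ j ∈ s, (∑ l ∈ t, star (e l i) * e l j) * x j := by
        simp only [Finset.mul_sum, Finset.sum_mul, mul_assoc]
        rw [Finset.sum_comm]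
    _ = ∑ j ∈ s, (if i = j then (N : ℂ) else 0) * x j :=
        Finset.sum_congr rfl fun j hj => by rw [h i hi j hj]
    _ = N * x i := by simp [hi]

lemma OrthogonalKernel.parseval (h : OrthogonalKernel t s e N) (x : ι → ℂ) :
    ∑ l ∈ t, ‖∑ i ∈ s, e l i * x i‖ ^ 2 = N * ∑ i ∈ s, ‖x i‖ ^ 2 := by
  have key : ∑ l ∈ t, star (∑ i ∈ s, e l i * x i) * ∑ i ∈ s, e l i * x i =
      N * ∑ i ∈ s, star (x i) * x i := by
    calc ∑ l ∈ t, star (∑ i ∈ s, e l i * x i) * ∑ i ∈ s, e l i * x i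
        = ∑ i ∈ s, star (x i) * ∑ l ∈ t, star (e l i) * ∑ j ∈ s, e l j * x j := by
          simp only [star_sum, star_mul, Finset.sum_mul _ (fun _ => _ * _), Finset.mul_sum s]
          rw [Finset.sum_comm]
          simp only [Finset.mul_sum, mul_assoc]
      _ = ∑ i ∈ s, star (x i) * (N * x i) :=
          Finset.sum_congr rfl fun i hi => by rw [h.inversion x hi]
      _ = _ := by rw [Finset.mul_sum]; exact Finset.sum_congr rfl fun i _ => by ring
  have hsq : ∀ z : ℂ, star z * z = ((‖z‖ ^ 2 : ℝ) : ℂ) := fun z => by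
    rw [Complex.star_def, Complex.conj_mul']; push_cast; rfl
  simp only [hsq] at key
  exact_mod_cast key

lemma OrthogonalKernel.inversion₂ (h : OrthogonalKernel t s e N)
    (h' : OrthogonalKernel t' s' e' N') (x : ι → ι' → ℂ) {i : ι} (hi : i ∈ s) {i' : ι'}
    (hi' : i' ∈ s') :
    ∑ l' ∈ t', ∑ l ∈ t, star (e' l' i') * star (e l i) *
      (∑ j ∈ s, ∑ j' ∈ s', e l j * e' l' j' * x j j') = N * N' * x i i' := by
  calc _ = ∑ l' ∈ t', star (e' l' i') * ∑ l ∈ t, star (e l i) *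
        (∑ j ∈ s, e l j * ∑ j' ∈ s', e' l' j' * x j j') := by
        simp only [Finset.mul_sum, mul_assoc]
    _ = ∑ l' ∈ t', star (e' l' i') * (N * ∑ j' ∈ s', e' l' j' * x i j') := by
        simp only [h.inversion _ hi]
    _ = N * ∑ l' ∈ t', star (e' l' i') * ∑ j' ∈ s', e' l' j' * x i j' := by
        rw [Finset.mul_sum]; exact Finset.sum_congr rfl fun _ _ => by ring
    _ = _ := by rw [h'.inversion _ hi']; ring

lemma OrthogonalKernel.parseval₂ (h : OrthogonalKernel t s e N)
    (h' : OrthogonalKernel t' s' e' N') (x : ι → ι' → ℂ) :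
    ∑ l' ∈ t', ∑ l ∈ t, ‖∑ j ∈ s, ∑ j' ∈ s', e l j * e' l' j' * x j j'‖ ^ 2 =
      N * N' * ∑ j ∈ s, ∑ j' ∈ s', ‖x j j'‖ ^ 2 := by
  calc _ = ∑ l' ∈ t', ∑ l ∈ t, ‖∑ j ∈ s, e l j * ∑ j' ∈ s', e' l' j' * x j j'‖ ^ 2 := by
        simp only [Finset.mul_sum, mul_assoc]
    _ = N * ∑ j ∈ s, ∑ l' ∈ t', ‖∑ j' ∈ s', e' l' j' * x j j'‖ ^ 2 := by
        simp only [h.parseval]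
        rw [← Finset.mul_sum, Finset.sum_comm]
    _ = _ := by simp only [h'.parseval]; rw [← Finset.mul_sum]; ring

end OrthogonalKernel

lemma eq_of_dvd_sub {n : ℕ} {i j a b : ℤ} (hi : a ≤ i ∧ i < b) (hj : a ≤ j ∧ j < b)
    (hab : b - a ≤ n) (h : (n : ℤ) ∣ -i + j) : i = j := by
  have := Int.eq_zero_of_abs_lt_dvd h (by rw [abs_lt]; omega)
  omega

/-- The map c assigns a frequency to each column; columns are orthogonal as soon as their
frequencies are distinct modulo n. This covers delay, Doppler and grid indices alike. -/
lemma orthogonalKernel_range {ι : Type*} [DecidableEq ι] {n : ℕ} (hn : 0 < n) {s : Finset ι}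
    (c : ι → ℤ) (hc : ∀ i ∈ s, ∀ j ∈ s, (n : ℤ) ∣ -c i + c j → i = j) :
    OrthogonalKernel (Finset.range n) s (fun l i => fourierKernel n (c i) l) n := by
  intro i hi j hj
  simp only [conj_fourierKernel, ← fourierKernel_add_left]
  rw [sum_range_fourierKernel hn]
  refine if_congr ⟨hc i hi j hj, ?_⟩ rfl rfl
  rintro rfl; simp

lemma orthogonalKernel_dopplerRange {ι : Type*} [DecidableEq ι] {n : ℕ} (hn : 0 < n)
    (he : Even n) {s : Finset ι}
    (c : ι → ℤ) (hc : ∀ i ∈ s, ∀ j ∈ s, (n : ℤ) ∣ -c i + c j → i = j) :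
    OrthogonalKernel (MIMOSystem.dopplerRange n) s (fun l i => fourierKernel n (c i) l) n := by
  intro i hi j hj
  simp only [conj_fourierKernel, ← fourierKernel_add_left]
  rw [sum_dopplerRange_fourierKernel hn he]
  refine if_congr ⟨hc i hi j hj, ?_⟩ rfl rfl
  rintro rfl; simp

lemma dopplerRange_mono {J L : ℕ} (h : J ≤ L) :
    MIMOSystem.dopplerRange J ⊆ MIMOSystem.dopplerRange L := by
  have := Nat.div_le_div_right (c := 2) h
  intro i; simp only [MIMOSystem.dopplerRange, Finset.mem_Ico]; omega

lemma exp_eq_fourierKernel_mul (K L k m l : ℕ) (i : ℤ) :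
    Complex.exp (-2 * Real.pi * Complex.I * ((k : ℂ) * m / K - (l : ℂ) * i / L)) =
      fourierKernel K (-m) k * fourierKernel L i l := by
  rw [fourierKernel, fourierKernel, ← Complex.exp_add]
  congr 1; push_cast; ring

lemma exp_eq_fourierKernel_mul' (J D m kap lam : ℕ) (i : ℤ) :
    Complex.exp (-2 * Real.pi * Complex.I * ((i : ℂ) * lam / J - (m : ℂ) * kap / D)) =
      fourierKernel J (-i) lam * fourierKernel D m kap := by
  rw [fourierKernel, fourierKernel, ← Complex.exp_add]
  congr 1; push_cast; ring

/-- Interpolation of the subsampled channel by the inverse and the forward discrete Fourier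
transform multiplies the squared error by the subsampling factor. -/
lemma dft_interpolation_error {K L D J : ℕ} (hK : 0 < K) (hL : 0 < L) (hD : D ∣ K) (hJ : J ∣ L)
    (he : Even J) (f : ℕ → ℤ → ℂ)
    (hf : ∀ m < K, ∀ i ∈ MIMOSystem.dopplerRange L, f m i ≠ 0 →
      m < D ∧ i ∈ MIMOSystem.dopplerRange J)
    (ch : (ℕ → ℤ → ℂ) → ℕ → ℕ → ℂ)
    (hch : ∀ f l k, ch f l k = ∑ m ∈ Finset.range K, ∑ i ∈ MIMOSystem.dopplerRange L,
      fourierKernel K (-m) k * fourierKernel L i l * f m i)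
    (h : Fin J → Fin D → ℂ) (fh : ℕ → ℤ → ℂ)
    (hfh : ∀ m i, fh m i = if m < D ∧ i ∈ MIMOSystem.dopplerRange J then
      (1 / ((J : ℂ) * D)) * ∑ lam : Fin J, ∑ kap : Fin D,
        fourierKernel J (-i) (lam : ℕ) * fourierKernel D m (kap : ℕ) * h lam kap else 0) :
    ∑ l ∈ Finset.range L, ∑ k ∈ Finset.range K, ‖ch fh l k - ch f l k‖ ^ 2 =
      (K * L : ℝ) / (J * D) * ∑ lam : Fin J, ∑ kap : Fin D,
        ‖h lam kap - ch f (lam * (L / J)) (kap * (K / D))‖ ^ 2 := by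
  have hDp : 0 < D := Nat.pos_of_dvd_of_pos hD hK
  have hJp : 0 < J := Nat.pos_of_dvd_of_pos hJ hL
  have heL : Even L := he.trans_dvd hJ
  have hDK : D ≤ K := Nat.le_of_dvd hK hD
  have hJL : J ≤ L := Nat.le_of_dvd hL hJ
  have hDC : (D : ℂ) ≠ 0 := by exact_mod_cast hDp.ne'
  have hJC : (J : ℂ) ≠ 0 := by exact_mod_cast hJp.ne'
  have hDR : (D : ℝ) ≠ 0 := by exact_mod_cast hDp.ne'
  have hJR : (J : ℝ) ≠ 0 := by exact_mod_cast hJp.ne'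
  -- orthogonality of the kernels
  have oneg : ∀ {n : ℕ}, 0 < n → OrthogonalKernel (Finset.range n) (Finset.range n)
      (fun (l m : ℕ) => fourierKernel n (-m) l) n := fun {n} hn =>
    orthogonalKernel_range hn _ fun i hi j hj hd => by
      have := eq_of_dvd_sub (n := n) (i := j) (j := i) (a := 0) (b := n) ⟨by positivity, by
        exact_mod_cast Finset.mem_range.1 hj⟩ ⟨by positivity, by
        exact_mod_cast Finset.mem_range.1 hi⟩ (by simp) (by rwa [neg_neg, add_comm] at hd)
      exact_mod_cast this.symm
  have odop : ∀ {n : ℕ}, 0 < n → Even n → OrthogonalKernel (Finset.range n)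
      (MIMOSystem.dopplerRange n) (fun (l : ℕ) (i : ℤ) => fourierKernel n i l) n := fun hn he =>
    orthogonalKernel_range hn _ fun i hi j hj hd =>
      eq_of_dvd_sub (Finset.mem_Ico.1 hi) (Finset.mem_Ico.1 hj) (by omega) hd
  -- Here grid points label the columns and the sums run over delay-Doppler indices, as Parseval for
  -- the inverse transform requires.
  have oneg' : OrthogonalKernel (MIMOSystem.dopplerRange J) (Finset.univ : Finset (Fin J))
      (fun i lam => fourierKernel J (-((lam : ℕ) : ℤ)) i) J :=
    orthogonalKernel_dopplerRange hJp he _ fun i _ j _ hd => by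
      have := eq_of_dvd_sub (n := J) (i := ((j : ℕ) : ℤ)) (j := ((i : ℕ) : ℤ)) (a := 0) (b := J)
        ⟨by positivity, by exact_mod_cast j.2⟩ ⟨by positivity, by exact_mod_cast i.2⟩
        (by simp) (by rwa [neg_neg, add_comm] at hd)
      exact (Fin.ext (by exact_mod_cast this)).symm
  have opos' : OrthogonalKernel (Finset.range D) (Finset.univ : Finset (Fin D))
      (fun m kap => fourierKernel D ((kap : ℕ) : ℤ) m) D :=
    orthogonalKernel_range hDp _ fun i _ j _ hd => by
      have := eq_of_dvd_sub (n := D) (i := ((i : ℕ) : ℤ)) (j := ((j : ℕ) : ℤ)) (a := 0) (b := D)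
        ⟨by positivity, by exact_mod_cast i.2⟩ ⟨by positivity, by exact_mod_cast j.2⟩
        (by simp) hd
      exact Fin.ext (by exact_mod_cast this)
  set d : ℕ → ℤ → ℂ := fun m i => fh m i - f m i with hd
  have hd0 : ∀ m < K, ∀ i ∈ MIMOSystem.dopplerRange L,
      ¬ (m < D ∧ i ∈ MIMOSystem.dopplerRange J) → d m i = 0 := fun m hm i hi hn => by
    have : f m i = 0 := by_contra fun h0 => hn (hf m hm i hi h0)
    rw [hd]; simp only [hfh, if_neg hn, this, sub_zero]
  have restrict : ∀ {M : Type} [AddCommMonoid M] (a : ℕ → ℤ → M),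
      (∀ m < K, ∀ i ∈ MIMOSystem.dopplerRange L,
        ¬ (m < D ∧ i ∈ MIMOSystem.dopplerRange J) → a m i = 0) →
      ∑ m ∈ Finset.range K, ∑ i ∈ MIMOSystem.dopplerRange L, a m i =
        ∑ m ∈ Finset.range D, ∑ i ∈ MIMOSystem.dopplerRange J, a m i := fun a ha => by
    symm
    calc _ = ∑ m ∈ Finset.range D, ∑ i ∈ MIMOSystem.dopplerRange L, a m i :=
          Finset.sum_congr rfl fun m hm => Finset.sum_subset (dopplerRange_mono hJL)
            fun i hi hi' => ha m ((Finset.mem_range.1 hm).trans_le hDK) i hi fun h => hi' h.2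
      _ = _ := Finset.sum_subset (Finset.range_subset_range.2 hDK) fun m hm hm' =>
          Finset.sum_eq_zero fun i hi => ha m (Finset.mem_range.1 hm) i hi
            fun h => hm' (Finset.mem_range.2 h.1)
  -- the full grid
  have hfull : ∑ l ∈ Finset.range L, ∑ k ∈ Finset.range K, ‖ch fh l k - ch f l k‖ ^ 2 =
      K * L * ∑ m ∈ Finset.range D, ∑ i ∈ MIMOSystem.dopplerRange J, ‖d m i‖ ^ 2 := by
    rw [← restrict (fun m i => ‖d m i‖ ^ 2) fun m hm i hi hn => by simp [hd0 m hm i hi hn],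
      ← (oneg hK).parseval₂ (odop hL heL) d]
    refine Finset.sum_congr rfl fun l _ => Finset.sum_congr rfl fun k _ => ?_
    rw [hch, hch, ← Finset.sum_sub_distrib]
    simp only [← Finset.sum_sub_distrib, ← mul_sub, hd]
  -- the subsampled grid
  have hgrid : ∀ lam kap : ℕ, ch f (lam * (L / J)) (kap * (K / D)) =
      ∑ m ∈ Finset.range D, ∑ i ∈ MIMOSystem.dopplerRange J,
        fourierKernel D (-m) kap * fourierKernel J i lam * f m i := fun lam kap => by
    rw [hch, restrict _ fun m hm i hi hn => by
      rw [by_contra fun h0 => hn (hf m hm i hi h0), mul_zero]]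
    refine Finset.sum_congr rfl fun m _ => Finset.sum_congr rfl fun i _ => ?_
    rw [fourierKernel_comm K, fourierKernel_comm L]
    rw [Nat.cast_mul, Nat.cast_mul, fourierKernel_mul_left hK hD, fourierKernel_mul_left hL hJ,
      fourierKernel_comm D, fourierKernel_comm J]
  -- The inverse DFT of the exact samples returns f on the region, so d is the inverse DFT of the
  -- sample errors.
  have hdreg : ∀ m ∈ Finset.range D, ∀ i ∈ MIMOSystem.dopplerRange J,
      d m i = (1 / ((J : ℂ) * D)) * ∑ lam : Fin J, ∑ kap : Fin D,
        fourierKernel J (-((lam : ℕ) : ℤ)) i * fourierKernel D ((kap : ℕ) : ℤ) m *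
          (h lam kap - ch f (lam * (L / J)) (kap * (K / D))) := fun m hm i hi => by
    have hinv := (oneg hDp).inversion₂ (odop hJp he) f hm hi
    simp only [← hgrid, conj_fourierKernel] at hinv
    rw [Finset.sum_range] at hinv
    simp only [Finset.sum_range (n := D)] at hinv
    have hfi : f m i = (1 / ((J : ℂ) * D)) * (D * J * f m i) := by field_simp
    rw [hd]
    simp only
    rw [hfh, if_pos ⟨Finset.mem_range.1 hm, hi⟩, hfi, ← hinv, ← mul_sub,
      ← Finset.sum_sub_distrib]
    congr 1
    refine Finset.sum_congr rfl fun lam _ => ?_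
    rw [← Finset.sum_sub_distrib]
    refine Finset.sum_congr rfl fun kap _ => ?_
    rw [neg_neg, ← mul_sub, fourierKernel_comm D m]
    congr 2
    rw [fourierKernel, fourierKernel]; congr 1; push_cast; ring
  rw [hfull]
  have hreg : ∑ m ∈ Finset.range D, ∑ i ∈ MIMOSystem.dopplerRange J, ‖d m i‖ ^ 2 =
      1 / (J * D : ℝ) * ∑ lam : Fin J, ∑ kap : Fin D,
        ‖h lam kap - ch f (lam * (L / J)) (kap * (K / D))‖ ^ 2 := by
    have := oneg'.parseval₂ opos' fun lam kap =>
      h lam kap - ch f (lam * (L / J)) (kap * (K / D))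
    calc _ = ∑ m ∈ Finset.range D, ∑ i ∈ MIMOSystem.dopplerRange J,
          (1 / (J * D : ℝ)) ^ 2 * ‖∑ lam : Fin J, ∑ kap : Fin D,
            fourierKernel J (-((lam : ℕ) : ℤ)) i * fourierKernel D ((kap : ℕ) : ℤ) m *
              (h lam kap - ch f (lam * (L / J)) (kap * (K / D)))‖ ^ 2 := by
          refine Finset.sum_congr rfl fun m hm => Finset.sum_congr rfl fun i hi => ?_
          rw [hdreg m hm i hi, norm_mul, mul_pow]; simp
      _ = _ := by
          simp only [← Finset.mul_sum]
          rw [this]; field_simp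
  rw [hreg]; ring

/-! ## The spectral norm -/

section SpecNorm

variable {n : ℕ} (M : Matrix (Fin n) (Fin n) ℂ)

lemma specNorm_nonneg : 0 ≤ specNorm M := norm_nonneg _

lemma l2norm_mulVec_le (v : Fin n → ℂ) : l2norm (M *ᵥ v) ≤ specNorm M * l2norm v :=
  (Matrix.toEuclideanCLM (𝕜 := ℂ) M).le_opNorm (WithLp.toLp 2 v)

lemma specNorm_conjTranspose : specNorm Mᴴ = specNorm M := by
  rw [specNorm, ← Matrix.star_eq_conjTranspose, map_star, ContinuousLinearMap.star_eq_adjoint,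
    LinearIsometryEquiv.norm_map, specNorm]

lemma l2norm_star {ι : Type*} [Fintype ι] (v : ι → ℂ) : l2norm (star v) = l2norm v := by
  refine (pow_left_inj₀ (l2norm_nonneg _) (l2norm_nonneg _) two_ne_zero).1 ?_
  simp [l2norm_sq]

/-- Mᵀ v is the conjugate of Mᴴ applied to the conjugate of v, and conjugation preserves norms. It
is needed because the pilots act on rows of G through Pᵀ. -/
lemma l2norm_transpose_mulVec_le (v : Fin n → ℂ) : l2norm (Mᵀ *ᵥ v) ≤ specNorm M * l2norm v := by
  have h : Mᵀ *ᵥ v = star (Mᴴ *ᵥ star v) := by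
    rw [Matrix.star_mulVec, star_star, Matrix.conjTranspose_conjTranspose, Matrix.mulVec_transpose]
  rw [h, l2norm_star, ← specNorm_conjTranspose, ← l2norm_star v]
  exact l2norm_mulVec_le _ _

end SpecNorm

namespace MIMOSystem

variable (sys : MIMOSystem)

/-! ## The measured coefficients -/

lemma D_pos : 0 < sys.D := Nat.pos_of_dvd_of_pos sys.D_dvd_K sys.K_pos

lemma J_pos : 0 < sys.J := Nat.pos_of_dvd_of_pos sys.J_dvd_L sys.L_pos

/-- The coefficients `G̃_{m,i}`, whose rows are `Pᵀ` applied to the rows of `G_{m,i}`. -/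
def pilotCoeff (F : ℕ → ℤ → sys.Mat) (c : sys.DD) : sys.Mat :=
  Matrix.of fun r => sys.pilotMatrixᵀ *ᵥ sys.coeff F c r

/-- The scaled coefficients measured by `Φ`. -/
def measured (F : ℕ → ℤ → sys.Mat) : sys.DD × sys.Chan → ℂ := fun cθ =>
  (√(sys.Q / (sys.J * sys.D : ℝ)) : ℂ) * sys.pilotCoeff F cθ.1 cθ.2.1 cθ.2.2

lemma sqrt_mul_sqrt : (√((sys.J * sys.D : ℝ) / sys.Q) : ℂ) * (√(sys.Q / (sys.J * sys.D : ℝ)) : ℂ)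
    = 1 := by
  have h1 : (0 : ℝ) < sys.Q := by exact_mod_cast sys.Q_pos
  have h2 : (0 : ℝ) < sys.J := by exact_mod_cast sys.J_pos
  have h3 : (0 : ℝ) < sys.D := by exact_mod_cast sys.D_pos
  rw [← Complex.ofReal_mul, ← Real.sqrt_mul (by positivity)]
  have : (sys.J * sys.D : ℝ) / sys.Q * (sys.Q / (sys.J * sys.D : ℝ)) = 1 := by field_simp
  rw [this, Real.sqrt_one, Complex.ofReal_one]

lemma sum_coeff_mul (F : ℕ → ℤ → sys.Mat) (μ : Fin sys.J × Fin sys.D) (r : Fin sys.NR)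
    (s : Fin sys.NT) : ∑ c, sys.u c μ * sys.coeff F c r s =
      sys.channel F (sys.gridTime μ) (sys.gridFreq μ) r s := by
  have h := sys.u.sum_repr
    (WithLp.toLp 2 fun μ => sys.channel F (sys.gridTime μ) (sys.gridFreq μ) r s)
  have h2 := congrArg (fun v : EuclideanSpace ℂ (Fin sys.J × Fin sys.D) => v μ) h
  simp only [WithLp.ofLp_sum, Finset.sum_apply, PiLp.smul_apply, smul_eq_mul] at h2
  rw [← h2]
  exact Finset.sum_congr rfl fun c _ => mul_comm _ _

/-- The sum of the squared values of a combination of the basis functions. -/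
lemma sum_norm_sq_basis (a : sys.DD → ℂ) :
    ∑ μ, ‖∑ c, sys.u c μ * a c‖ ^ 2 = ∑ c, ‖a c‖ ^ 2 := by
  have h := sys.u.sum_repr_symm (WithLp.toLp 2 a)
  have h2 : ‖sys.u.repr.symm (WithLp.toLp 2 a)‖ ^ 2 =
      ‖(WithLp.toLp 2 a : EuclideanSpace ℂ _)‖ ^ 2 := by
    rw [LinearIsometryEquiv.norm_map]
  rw [← h, EuclideanSpace.norm_sq_eq, EuclideanSpace.norm_sq_eq] at h2
  rw [← h2]
  refine Finset.sum_congr rfl fun μ _ => ?_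
  simp only [WithLp.ofLp_sum, Finset.sum_apply, PiLp.smul_apply, smul_eq_mul]
  congr 2
  exact Finset.sum_congr rfl fun c _ => mul_comm _ _

/-- The received pilot symbols are noisy compressed measurements. -/
lemma PhiStack_mulVec_measured (F : ℕ → ℤ → sys.Mat) {a : ℕ → ℕ → Fin sys.NT → ℂ}
    (ha : sys.TransmitsPilots a) (z : ℕ → ℕ → Fin sys.NR → ℂ) :
    sys.PhiStack *ᵥ sys.measured F - sys.stackPilots (sys.received F a z) =
      - sys.stackPilots z := by
  ext ⟨q, r, s⟩
  have h1 : (sys.PhiStack *ᵥ sys.measured F) (q, r, s) =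
      ∑ c, sys.u c (sys.pos s q) * sys.pilotCoeff F c r s := by
    simp only [PhiStack, Matrix.mulVec, dotProduct]
    rw [Fintype.sum_prod_type]
    refine Finset.sum_congr rfl fun c _ => ?_
    simp only [Matrix.blockDiagonal_apply, ite_mul, zero_mul, Finset.sum_ite_eq, Finset.mem_univ,
      if_true, Phi, measured, Matrix.of_apply]
    linear_combination (sys.u c (sys.pos s q) * sys.pilotCoeff F c r s) * sys.sqrt_mul_sqrt
  -- Interchanging the sums over basis functions and antennas turns the expansion of Pᵀ G into the
  -- channel applied to p^(s).
  have h2 : ∑ c, sys.u c (sys.pos s q) * sys.pilotCoeff F c r s =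
      ∑ t, sys.channel F (sys.gridTime (sys.pos s q)) (sys.gridFreq (sys.pos s q)) r t *
        sys.p s t := by
    simp only [← sum_coeff_mul, pilotCoeff, Matrix.of_apply, Matrix.mulVec, dotProduct,
      Finset.mul_sum, Finset.sum_mul, Matrix.transpose_apply, pilotMatrix]
    rw [Finset.sum_comm]
    exact Finset.sum_congr rfl fun t _ => Finset.sum_congr rfl fun c _ => by ring
  rw [Pi.sub_apply, h1, h2]
  simp only [stackPilots, atPilots, received, ha s q, Pi.add_apply, Pi.neg_apply, Matrix.mulVec,
    dotProduct]
  ring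

lemma l2norm_stackPilots (z : ℕ → ℕ → Fin sys.NR → ℂ) :
    l2norm (sys.stackPilots z) = √(∑ θ, l2norm (sys.atPilots z θ) ^ 2) := by
  rw [← Real.sqrt_sq (l2norm_nonneg _)]
  congr 1
  rw [l2norm_sq, Fintype.sum_prod_type_right]
  simp only [l2norm_sq, stackPilots]

/-! ## From the compressed sensing error to the channel estimation error -/

lemma sum_chan {M : Type*} [AddCommMonoid M] (f : sys.Chan → M) :
    ∑ θ, f θ = ∑ r, ∑ s, f (r, s) := Fintype.sum_prod_type f

lemma isUnit_det_pilotMatrix : IsUnit sys.pilotMatrixᵀ.det := by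
  rw [← Matrix.isUnit_iff_isUnit_det]
  exact Matrix.linearIndependent_rows_iff_isUnit.1 sys.p_indep

lemma coeff_row_eq (F : ℕ → ℤ → sys.Mat) (c : sys.DD) (r : Fin sys.NR) :
    sys.coeff F c r = (sys.pilotMatrixᵀ)⁻¹ *ᵥ sys.pilotCoeff F c r := by
  change _ = (sys.pilotMatrixᵀ)⁻¹ *ᵥ (sys.pilotMatrixᵀ *ᵥ sys.coeff F c r)
  rw [Matrix.mulVec_mulVec, Matrix.nonsing_inv_mul _ sys.isUnit_det_pilotMatrix, Matrix.one_mulVec]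

lemma GtildeHat_sub_pilotCoeff (F : ℕ → ℤ → sys.Mat) (xh : sys.DD × sys.Chan → ℂ) (c : sys.DD)
    (r : Fin sys.NR) (s : Fin sys.NT) :
    sys.GtildeHat xh c r s - sys.pilotCoeff F c r s =
      (√((sys.J * sys.D : ℝ) / sys.Q) : ℂ) * (xh - sys.measured F) (c, r, s) := by
  simp only [GtildeHat, Matrix.of_apply, Pi.sub_apply, measured]
  linear_combination (sys.pilotCoeff F c r s) * sys.sqrt_mul_sqrt

/-- The squared error of the coefficients of the subsampled channel. -/
lemma sum_norm_sq_GHat_sub_le (F : ℕ → ℤ → sys.Mat) (xh : sys.DD × sys.Chan → ℂ) :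
    ∑ θ : sys.Chan, ∑ c, ‖sys.GHat xh c θ.1 θ.2 - sys.coeff F c θ.1 θ.2‖ ^ 2 ≤
      specNorm sys.pilotMatrix⁻¹ ^ 2 * ((sys.J * sys.D : ℝ) / sys.Q) *
        l2norm (xh - sys.measured F) ^ 2 := by
  have hrow : ∀ c r, ∑ s, ‖sys.GHat xh c r s - sys.coeff F c r s‖ ^ 2 ≤
      specNorm sys.pilotMatrix⁻¹ ^ 2 *
        ∑ s, ‖sys.GtildeHat xh c r s - sys.pilotCoeff F c r s‖ ^ 2 := fun c r => by
    have h := l2norm_transpose_mulVec_le sys.pilotMatrix⁻¹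
      (sys.GtildeHat xh c r - sys.pilotCoeff F c r)
    have h2 := pow_le_pow_left₀ (l2norm_nonneg _) h 2
    rw [mul_pow, l2norm_sq, l2norm_sq, Matrix.transpose_nonsing_inv, Matrix.mulVec_sub,
      ← coeff_row_eq] at h2
    exact h2
  rw [Finset.sum_comm]
  simp only [sum_chan]
  have hQ : (0 : ℝ) ≤ (sys.J * sys.D : ℝ) / sys.Q := by positivity
  calc _ ≤ ∑ c, ∑ r, specNorm sys.pilotMatrix⁻¹ ^ 2 *
        ∑ s, ‖sys.GtildeHat xh c r s - sys.pilotCoeff F c r s‖ ^ 2 :=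
        Finset.sum_le_sum fun c _ => Finset.sum_le_sum fun r _ => hrow c r
    _ = _ := by
        simp only [GtildeHat_sub_pilotCoeff, norm_mul, mul_pow, Complex.norm_real, Real.norm_eq_abs,
          sq_abs, Real.sq_sqrt hQ, ← Finset.mul_sum]
        rw [l2norm_sq, Fintype.sum_prod_type
          fun cθ : sys.DD × sys.Chan => ‖(xh - sys.measured F) cθ‖ ^ 2]
        simp only [sum_chan]
        ring

lemma HSubHat_apply (xh : sys.DD × sys.Chan → ℂ) (μ : Fin sys.J × Fin sys.D) (r : Fin sys.NR)
    (s : Fin sys.NT) : sys.HSubHat xh μ r s = ∑ c, sys.u c μ * sys.GHat xh c r s := by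
  simp [HSubHat, Matrix.sum_apply]

lemma channel_apply (F : ℕ → ℤ → sys.Mat) (l k : ℕ) (r : Fin sys.NR) (s : Fin sys.NT) :
    sys.channel F l k r s = ∑ m ∈ Finset.range sys.K, ∑ i ∈ dopplerRange sys.L,
      fourierKernel sys.K (-m) k * fourierKernel sys.L i l * F m i r s := by
  simp only [channel, Matrix.sum_apply, Matrix.smul_apply, smul_eq_mul, exp_eq_fourierKernel_mul]

lemma FHat_apply (xh : sys.DD × sys.Chan → ℂ) (m : ℕ) (i : ℤ) (r : Fin sys.NR)
    (s : Fin sys.NT) :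
    sys.FHat xh m i r s = if m < sys.D ∧ i ∈ dopplerRange sys.J then
      (1 / ((sys.J : ℂ) * sys.D)) * ∑ lam : Fin sys.J, ∑ kap : Fin sys.D,
        fourierKernel sys.J (-i) (lam : ℕ) * fourierKernel sys.D m (kap : ℕ) *
          sys.HSubHat xh (lam, kap) r s else 0 := by
  rw [FHat]
  split_ifs
  · simp only [Matrix.sum_apply, Matrix.smul_apply, smul_eq_mul, exp_eq_fourierKernel_mul']
  · rfl

/-- The channel estimation error is controlled by the error of compressed sensing. -/
theorem rmse_le {F : ℕ → ℤ → sys.Mat} (hF : sys.SupportedInRegion F)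
    (xh : sys.DD × sys.Chan → ℂ) :
    sys.rmse F xh ≤ √((sys.K * sys.L : ℝ) / sys.Q) * specNorm sys.pilotMatrix⁻¹ *
      l2norm (xh - sys.measured F) := by
  have hQ : (0 : ℝ) < sys.Q := by exact_mod_cast sys.Q_pos
  have hJ : (0 : ℝ) < sys.J := by exact_mod_cast sys.J_pos
  have hD : (0 : ℝ) < sys.D := by exact_mod_cast sys.D_pos
  refine Real.sqrt_le_iff.2 ⟨mul_nonneg (mul_nonneg (Real.sqrt_nonneg _) (specNorm_nonneg _))
    (l2norm_nonneg _), ?_⟩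
  have hθ : ∀ θ : sys.Chan, ∑ l ∈ Finset.range sys.L, ∑ k ∈ Finset.range sys.K,
      ‖sys.HHat xh l k θ.1 θ.2 - sys.channel F l k θ.1 θ.2‖ ^ 2 =
      (sys.K * sys.L : ℝ) / (sys.J * sys.D) *
        ∑ c, ‖sys.GHat xh c θ.1 θ.2 - sys.coeff F c θ.1 θ.2‖ ^ 2 := fun θ => by
    have h := dft_interpolation_error sys.K_pos sys.L_pos sys.D_dvd_K sys.J_dvd_L sys.J_even
      (fun m i => F m i θ.1 θ.2)
      (fun m hm i hi h0 => hF m hm i hi fun h => h0 (by rw [h]; rfl))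
      (fun f l k => ∑ m ∈ Finset.range sys.K, ∑ i ∈ dopplerRange sys.L,
        fourierKernel sys.K (-m) k * fourierKernel sys.L i l * f m i) (fun _ _ _ => rfl)
      (fun lam kap => sys.HSubHat xh (lam, kap) θ.1 θ.2)
      (fun m i => sys.FHat xh m i θ.1 θ.2) (fun m i => sys.FHat_apply xh m i θ.1 θ.2)
    simp only [← channel_apply] at h
    rw [← sum_norm_sq_basis]
    refine h.trans ?_
    rw [← Fintype.sum_prod_type fun μ : Fin sys.J × Fin sys.D =>
      ‖sys.HSubHat xh (μ.1, μ.2) θ.1 θ.2 -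
        sys.channel F (μ.1 * (sys.L / sys.J)) (μ.2 * (sys.K / sys.D)) θ.1 θ.2‖ ^ 2]
    congr 1
    refine Finset.sum_congr rfl fun μ _ => ?_
    have h3 := sys.sum_coeff_mul F μ θ.1 θ.2
    rw [gridTime, gridFreq] at h3
    rw [HSubHat_apply, ← h3, ← Finset.sum_sub_distrib]
    simp only [mul_sub]
  simp only [hθ]
  rw [← Finset.mul_sum, mul_pow, mul_pow, Real.sq_sqrt (by positivity)]
  calc _ ≤ (sys.K * sys.L : ℝ) / (sys.J * sys.D) * (specNorm sys.pilotMatrix⁻¹ ^ 2 *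
        ((sys.J * sys.D : ℝ) / sys.Q) * l2norm (xh - sys.measured F) ^ 2) := by
        gcongr; exact sys.sum_norm_sq_GHat_sub_le F xh
    _ = _ := by field_simp

/-! ## Norms of the measured coefficients -/

/-- Pᵀ mixes transmit antennas for a fixed coefficient and receive antenna, never different
coefficients. The bound therefore holds over any set C: all coefficients give the total norm, a
single group gives the leakage. -/
lemma sum_norm_sq_measured_le (F : ℕ → ℤ → sys.Mat) (C : Finset sys.DD) :
    ∑ c ∈ C, ∑ θ : sys.Chan, ‖sys.measured F (c, θ)‖ ^ 2 ≤
      (sys.Q / (sys.J * sys.D : ℝ)) * specNorm sys.pilotMatrix ^ 2 *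
        ∑ θ : sys.Chan, ∑ c ∈ C, ‖sys.coeff F c θ.1 θ.2‖ ^ 2 := by
  have hrow : ∀ c r, ∑ s, ‖sys.pilotCoeff F c r s‖ ^ 2 ≤
      specNorm sys.pilotMatrix ^ 2 * ∑ s, ‖sys.coeff F c r s‖ ^ 2 := fun c r => by
    have h2 := pow_le_pow_left₀ (l2norm_nonneg _)
      (l2norm_transpose_mulVec_le sys.pilotMatrix (sys.coeff F c r)) 2
    rwa [mul_pow, l2norm_sq, l2norm_sq] at h2
  have hQ : (0 : ℝ) ≤ sys.Q / (sys.J * sys.D : ℝ) := by positivity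
  rw [Finset.sum_comm (s := Finset.univ) (t := C)]
  simp only [sum_chan, measured, norm_mul, mul_pow, Complex.norm_real, Real.norm_eq_abs, sq_abs,
    Real.sq_sqrt hQ, ← Finset.mul_sum]
  rw [mul_assoc]
  gcongr
  rw [Finset.mul_sum]
  refine Finset.sum_le_sum fun c _ => ?_
  rw [Finset.mul_sum]
  exact Finset.sum_le_sum fun r _ => hrow c r

lemma l2norm_measured_le (F : ℕ → ℤ → sys.Mat) :
    l2norm (sys.measured F) ≤ √(sys.Q / (sys.J * sys.D : ℝ)) * specNorm sys.pilotMatrix *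
      √(∑ θ : sys.Chan, ∑ c : sys.DD, ‖sys.coeff F c θ.1 θ.2‖ ^ 2) := by
  refine abs_le_of_sq_le_sq' ?_ (mul_nonneg (mul_nonneg (Real.sqrt_nonneg _) (specNorm_nonneg _))
    (Real.sqrt_nonneg _)) |>.2
  rw [l2norm_sq, Fintype.sum_prod_type, mul_pow, mul_pow, Real.sq_sqrt (by positivity),
    Real.sq_sqrt (by positivity)]
  exact sys.sum_norm_sq_measured_le F Finset.univ

variable {β : Type*} [Fintype β] [DecidableEq β]

omit [Fintype β] in
lemma l2norm_subvec_measured_le (F : ℕ → ℤ → sys.Mat) (g : sys.DD → β) (b : β) :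
    l2norm (subvec (sys.stackPartition g) (sys.measured F) b) ≤
      √(sys.Q / (sys.J * sys.D : ℝ)) * specNorm sys.pilotMatrix *
        √(∑ θ : sys.Chan, l2norm (subvec g (fun c => sys.coeff F c θ.1 θ.2) b) ^ 2) := by
  refine abs_le_of_sq_le_sq' ?_ (mul_nonneg (mul_nonneg (Real.sqrt_nonneg _) (specNorm_nonneg _))
    (Real.sqrt_nonneg _)) |>.2
  rw [mul_pow, mul_pow, Real.sq_sqrt (by positivity), Real.sq_sqrt (by positivity)]
  simp only [l2norm_subvec_sq]
  refine le_trans (le_of_eq ?_) (sys.sum_norm_sq_measured_le F (Finset.univ.filter (g · = b)))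
  rw [Finset.sum_filter, Fintype.sum_prod_type, Finset.sum_filter]
  refine Finset.sum_congr rfl fun c _ => ?_
  by_cases hc : g c = b <;> simp [stackPartition, hc]

lemma leakage_measured_le (F : ℕ → ℤ → sys.Mat) (g : sys.DD → β) (A : Finset β) :
    ∑ b ∈ Aᶜ, l2norm (subvec (sys.stackPartition g) (sys.measured F) b) ≤
      √(sys.Q / (sys.J * sys.D : ℝ)) * specNorm sys.pilotMatrix * sys.leakage g A F := by
  rw [leakage, Finset.mul_sum]
  exact Finset.sum_le_sum fun b _ => sys.l2norm_subvec_measured_le F g b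

/-- The channel error bound obtained from an error bound of compressed sensing. -/
lemma rmse_le_of_error_bound {F : ℕ → ℤ → sys.Mat} (hF : sys.SupportedInRegion F)
    {xh : sys.DD × sys.Chan → ℂ} (g : sys.DD → β) (A : Finset β) {a b c ε : ℝ} (ha : 0 ≤ a)
    (hc : 0 ≤ c)
    (h : l2norm (xh - sys.measured F) ≤
      a * (∑ b ∈ Aᶜ, l2norm (subvec (sys.stackPartition g) (sys.measured F) b)) + b * ε +
        c * l2norm (sys.measured F)) :
    sys.rmse F xh ≤ a * √((sys.K * sys.L : ℝ) / (sys.J * sys.D)) * sys.CP * sys.leakage g A F +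
      b * √((sys.K * sys.L : ℝ) / sys.Q) * specNorm sys.pilotMatrix⁻¹ * ε +
      c * sys.CP * √((sys.K * sys.L : ℝ) / (sys.J * sys.D) *
        ∑ θ : sys.Chan, ∑ c : sys.DD, ‖sys.coeff F c θ.1 θ.2‖ ^ 2) := by
  have hQ : (0 : ℝ) < sys.Q := by exact_mod_cast sys.Q_pos
  -- The factor √(Q/JD) from measuring combines with √(KL/Q) from reconstruction, so Q cancels in
  -- the signal terms.
  have hr : √((sys.K * sys.L : ℝ) / (sys.J * sys.D)) =
      √((sys.K * sys.L : ℝ) / sys.Q) * √(sys.Q / (sys.J * sys.D : ℝ)) := by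
    rw [← Real.sqrt_mul (by positivity)]; congr 1; field_simp
  have hP := specNorm_nonneg sys.pilotMatrix⁻¹
  rw [Real.sqrt_mul (by positivity), hr, CP]
  calc sys.rmse F xh ≤ √((sys.K * sys.L : ℝ) / sys.Q) * specNorm sys.pilotMatrix⁻¹ *
        l2norm (xh - sys.measured F) := sys.rmse_le hF xh
    _ ≤ √((sys.K * sys.L : ℝ) / sys.Q) * specNorm sys.pilotMatrix⁻¹ *
        (a * (√(sys.Q / (sys.J * sys.D : ℝ)) * specNorm sys.pilotMatrix * sys.leakage g A F) +
          b * ε + c * (√(sys.Q / (sys.J * sys.D : ℝ)) * specNorm sys.pilotMatrix *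
            √(∑ θ : sys.Chan, ∑ c : sys.DD, ‖sys.coeff F c θ.1 θ.2‖ ^ 2))) := by
        refine mul_le_mul_of_nonneg_left (h.trans ?_) (by positivity)
        have h1 := mul_le_mul_of_nonneg_left (sys.leakage_measured_le F g A) ha
        have h2 := mul_le_mul_of_nonneg_left (sys.l2norm_measured_le F) hc
        linarith
    _ = _ := by ring

/-! ### Restricted isometry of the stacked measurement matrix -/

omit [DecidableEq β] in
lemma gRIPWith_PhiStack {g : sys.DD → β} {n : ℕ} {δ : ℝ}
    (h : ∀ s, GRIPWith g n (sys.Phi s) δ) :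
    GRIPWith (sys.stackPartition g) n sys.PhiStack δ := by
  classical
  exact gRIPWith_blockDiagonal (Φ := fun θ : sys.Chan => sys.Phi θ.2) fun θ => h θ.2

omit [DecidableEq β] in
/-- The restricted isometry constant of the stacked matrix obeys the bound of its blocks, and it
is attained. -/
lemma gRIC_PhiStack {g : sys.DD → β} {n : ℕ} {δ₀ : ℝ} (h0 : 0 < δ₀)
    (h : ∀ s, HasGRIP g n (sys.Phi s) ∧ gRIC g n (sys.Phi s) < δ₀) :
    GRIPWith (sys.stackPartition g) n sys.PhiStack (gRIC (sys.stackPartition g) n sys.PhiStack) ∧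
      gRIC (sys.stackPartition g) n sys.PhiStack < δ₀ := by
  -- The maximum over the finitely many blocks keeps the inequality strict; with no transmit
  -- antennas δ = 0 serves.
  obtain ⟨δ, hδ0, hδ1, hδ⟩ : ∃ δ, 0 ≤ δ ∧ δ < δ₀ ∧ ∀ s, gRIC g n (sys.Phi s) ≤ δ := by
    rcases isEmpty_or_nonempty (Fin sys.NT) with he | he
    · exact ⟨0, le_rfl, h0, fun s => he.elim s⟩
    · obtain ⟨s, hs⟩ := Finite.exists_max fun s => gRIC g n (sys.Phi s)
      exact ⟨_, gRIC_nonneg _ _ _, (h s).2, hs⟩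
  have hstack := sys.gRIPWith_PhiStack fun s => ((h s).1.gRIPWith_gRIC).mono (hδ s)
  exact ⟨gRIPWith_gRIC hδ0 hstack, (gRIC_le hδ0 hstack).trans_lt hδ1⟩

end MIMOSystem

/-! ### Assembly of the two channel estimation bounds -/

lemma c0_nonneg {δ : ℝ} (h : δ < √2 - 1) : 0 ≤ c0 δ := by
  have h2 : √(2 : ℝ) ^ 2 = 2 := Real.sq_sqrt (by norm_num)
  have h22 : 0 ≤ √(2 : ℝ) := by positivity
  refine div_nonneg ?_ ?_ <;> nlinarith

end MGCS

end

theorem theorem1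
    (sys : MGCS.MIMOSystem)
    -- the partition used by the reconstruction method, `S` and the set of `S` groups
    {B : ℕ} (g : sys.DD → Fin B) (S : ℕ) (hS : 0 < S)
    (A : Finset (Fin B)) (hA : A.card = S)
    -- the channel, the transmitted symbols and the noise
    (F : ℕ → ℤ → sys.Mat) (hF : sys.SupportedInRegion F)
    (a : ℕ → ℕ → Fin sys.NT → ℂ) (ha : sys.TransmitsPilots a)
    (z : ℕ → ℕ → Fin sys.NR → ℂ)
    (ε : ℝ) (hε : 0 < ε)
    (hz : √(∑ θ : sys.Chan, MGCS.l2norm (sys.atPilots z θ) ^ 2) ≤ ε) :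
    -- group basis pursuit denoising
    ((∀ s, MGCS.HasGRIP g (2 * S) (sys.Phi s) ∧ MGCS.gRIC g (2 * S) (sys.Phi s) < √2 - 1) →
      ∀ xh : sys.DD × sys.Chan → ℂ,
        MGCS.IsGBPDNSolution (sys.stackPartition g) sys.PhiStack
          (sys.stackPilots (sys.received F a z)) ε xh →
        sys.rmse F xh ≤
          MGCS.c0 (MGCS.gRIC (sys.stackPartition g) (2 * S) sys.PhiStack) *
              √((sys.K * sys.L : ℝ) / (sys.J * sys.D)) * sys.CP *
              (sys.leakage g A F / √S) +
            MGCS.c1 (MGCS.gRIC (sys.stackPartition g) (2 * S) sys.PhiStack) *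
              √((sys.K * sys.L : ℝ) / sys.Q) * MGCS.specNorm sys.pilotMatrix⁻¹ * ε) ∧
    -- group CoSaMP
    ((∀ s, MGCS.HasGRIP g (4 * S) (sys.Phi s) ∧ MGCS.gRIC g (4 * S) (sys.Phi s) ≤ 0.1) →
      ∀ (n : ℕ) (xh : sys.DD × sys.Chan → ℂ),
        MGCS.IsGCoSaMPIterate (sys.stackPartition g) S sys.PhiStack
          (sys.stackPilots (sys.received F a z)) n xh →
        sys.rmse F xh ≤
          20 * √((sys.K * sys.L : ℝ) / (sys.J * sys.D)) * sys.CP *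
              (1 + 1 / √S) * sys.leakage g A F +
            20 * √((sys.K * sys.L : ℝ) / sys.Q) * MGCS.specNorm sys.pilotMatrix⁻¹ * ε +
            1 / 2 ^ n * sys.CP *
              √((sys.K * sys.L : ℝ) / (sys.J * sys.D) *
                ∑ θ : sys.Chan, ∑ c : sys.DD, ‖sys.coeff F c θ.1 θ.2‖ ^ 2)) := by
  have hnoise : MGCS.l2norm (sys.PhiStack *ᵥ sys.measured F -
      sys.stackPilots (sys.received F a z)) ≤ ε := by
    rw [sys.PhiStack_mulVec_measured F ha z, ← zero_sub, MGCS.l2norm_sub_comm, sub_zero,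
      sys.l2norm_stackPilots]
    exact hz
  constructor
  · intro h xh hxh
    have h2 : (1 : ℝ) < √2 := Real.lt_sqrt_of_sq_lt (by norm_num)
    obtain ⟨hrip, hlt⟩ := sys.gRIC_PhiStack (by linarith) h
    set δ := MGCS.gRIC (sys.stackPartition g) (2 * S) sys.PhiStack
    have herr := hxh.error_bound hnoise hS (MGCS.gRIC_nonneg _ _ _) hlt hrip hA
    have hfin := sys.rmse_le_of_error_bound hF (xh := xh) g A (a := MGCS.c0 δ / √S)
      (b := MGCS.c1 δ) (c := 0) (ε := ε) (div_nonneg (MGCS.c0_nonneg hlt) (Real.sqrt_nonneg _))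
      le_rfl (herr.trans (le_of_eq (by ring)))
    exact hfin.trans (le_of_eq (by ring))
  · intro h n xh hxh
    have hrip := sys.gRIPWith_PhiStack fun s => ((h s).1.gRIPWith_gRIC).mono (h s).2
    have herr := hxh.error_bound hS hrip hnoise hA
    have hfin := sys.rmse_le_of_error_bound hF (xh := xh) g A (a := 20 * (1 + 1 / √S))
      (b := 20) (c := 1 / 2 ^ n) (ε := ε) (by positivity) (by positivity) herr
    exact hfin.trans (le_of_eq (by ring))
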